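/- Let $\mathcal G$ be a planar graph (loops and multiple edges allowed) embedded in $\mathbb R^2$, invariant under translations by $\mathbb Z^2$, with finite quotient $\mathcal G_1=\mathcal G/\mathbb Z^2$, a graph embedded in the torus $\mathbb T^2=\mathbb R^2/\mathbb Z^2$. A flow on $\mathcal G_1$ is a real function $\omega$ on oriented edges such that $\omega(-e)=-\omega(e)$, where $-e$ is the edge $e$ with reversed orientation, and such that for every vertex $v$ the sum of $\omega(e)$ over the oriented edges $e$ starting at $v$ is $0$. Let $\mathcal F$ be the set of flows of capacity $1$ at each vertex, that is, for which at every vertex $v$ the inflow (the sum of the positive values $\omega(e)$ over the oriented edges $e$ ending at $v$) is at most $1$. A flow is a real $1$-cycle on $\mathcal G_1$, so it has a class $[\omega]\in H_1(\mathbb T^2,\mathbb R)\cong\mathbb R^2$. The unit flow polygon is $N=\{[\omega]:\omega\in\mathcal F\}\subset\mathbb R^2$. Then for every integer point $(i,j)\in N\cap\mathbb Z^2$ there is a flow $\omega\in\mathcal F$ with $[\omega]=(i,j)$ which takes only the values $0,1,-1$, and such that the oriented edges $e$ with $\omega(e)=1$ are exactly the edges of a (possibly empty) collection of pairwise vertex-disjoint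 oriented simple closed loops on $\mathcal G_1$. -/

import Mathlib

open scoped unitInterval

noncomputable section

/-- The vector of `ℝ²` given by an element of the lattice `ℤ²`. -/
def latticeVec (k : ℤ × ℤ) : ℝ × ℝ := ((k.1 : ℝ), (k.2 : ℝ))

/-- A graph embedded in the torus `ℝ²/ℤ²`, presented through the `ℤ²`-periodic graph embedded in
the plane that covers it. `V` is the set of vertices and `D` the set of oriented edges of the
quotient graph; loops and multiple edges are allowed, and so are disconnected graphs.
The periodic plane graph has the vertices `pos v + k` and the oriented edges `arc d + k` with
`k ∈ ℤ²`, so that `pos v` and `arc d` are representatives of the translation classes. -/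
structure TorusGraph (V D : Type*) where
  /-- the starting vertex of an oriented edge -/
  src : D → V
  /-- the same edge with the reverse orientation -/
  rev : D → D
  rev_rev : ∀ d, rev (rev d) = d
  rev_ne : ∀ d, rev d ≠ d
  /-- a point of the plane over each vertex -/
  pos : V → ℝ × ℝ
  /-- an arc in the plane over each oriented edge -/
  arc : D → C(I, ℝ × ℝ)
  /-- distinct vertices lie at distinct points of the torus -/
  pos_inj : ∀ u v k, pos u + latticeVec k = pos v → u = v
  arc_rev : ∀ d t, arc (rev d) t = arc d (σ t)
  /-- an arc starts at a lift of its starting vertex (and, by `arc_rev`, ends at a lift of the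
  starting vertex of its reverse) -/
  arc_zero : ∀ d, ∃ k, arc d 0 = pos (src d) + latticeVec k
  /-- the interior of an edge contains no vertex -/
  arc_ne_pos : ∀ d, ∀ t ∈ Set.Ioo (0 : I) 1, ∀ v k, arc d t ≠ pos v + latticeVec k
  /-- the interiors of the edges of the periodic plane graph are simple and pairwise disjoint -/
  arc_disjoint : ∀ d e, ∀ s ∈ Set.Ioo (0 : I) 1, ∀ t ∈ Set.Ioo (0 : I) 1, ∀ k,
    arc d s + latticeVec k = arc e t → (e = d ∧ t = s) ∨ (e = rev d ∧ t = σ s)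

namespace TorusGraph

variable {V D : Type*}

/-- The end vertex of an oriented edge. -/
def tgt (G : TorusGraph V D) (d : D) : V := G.src (G.rev d)

/-- A flow: an antisymmetric function on oriented edges with zero net outflow at each vertex. -/
def IsFlow [Fintype D] [DecidableEq V] (G : TorusGraph V D) (ω : D → ℝ) : Prop :=
  (∀ d, ω (G.rev d) = -ω d) ∧ ∀ v, ∑ d with G.src d = v, ω d = 0

/-- The inflow at `v`: the sum of the positive values of `ω` on oriented edges ending at `v`. -/
def inflow [Fintype D] [DecidableEq V] (G : TorusGraph V D) (ω : D → ℝ) (v : V) : ℝ :=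
  ∑ d with G.tgt d = v, max (ω d) 0

/-- The flows of capacity `1` at each vertex. -/
def unitFlows [Fintype D] [DecidableEq V] (G : TorusGraph V D) : Set (D → ℝ) :=
  {ω | G.IsFlow ω ∧ ∀ v, G.inflow ω v ≤ 1}

/-- The displacement in the plane along the lift of an oriented edge; it does not depend on the
lift. -/
def displacement (G : TorusGraph V D) (d : D) : ℝ × ℝ := G.arc d 1 - G.arc d 0

/-- The class in `H₁(ℝ²/ℤ², ℝ) = ℝ²` of a flow, that is, of the real 1-cycle `ω`: its periods
against the closed forms `dx` and `dy`. Every unoriented edge occurs in the sum with both of its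
orientations, which contribute the same, whence the factor `1/2`. -/
def homologyClass [Fintype D] (G : TorusGraph V D) (ω : D → ℝ) : ℝ × ℝ :=
  (1 / 2 : ℝ) • ∑ d, ω d • G.displacement d

/-- The unit flow polygon: the set of classes in `H₁(ℝ²/ℤ², ℝ) = ℝ²` of the flows of
capacity `1`. (The graph has no 2-cells, so a flow is the same as a class in `H₁` of the graph.) -/
def unitFlowPolygon [Fintype D] [DecidableEq V] (G : TorusGraph V D) : Set (ℝ × ℝ) :=
  G.homologyClass '' G.unitFlows

/-- An oriented closed loop on the torus graph: a nonempty cyclic sequence of oriented edges, each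
ending where the next one starts, which visits no vertex twice. -/
def IsLoop (G : TorusGraph V D) (c : Cycle D) : Prop :=
  c ≠ Cycle.nil ∧ c.Chain (fun d e => G.tgt d = G.src e) ∧ (c.map G.src).Nodup

/-- Two loops without a common vertex. -/
def VertexDisjoint (G : TorusGraph V D) (c c' : Cycle D) : Prop :=
  ∀ d ∈ c, ∀ d' ∈ c', G.src d ≠ G.src d'

end TorusGraph

end

/-!
Up to its contractible loops, a finite torus graph is a minor of a fine `N`-periodic square grid:
its vertices are contractions of disjoint connected blobs of grid points, and its edges are grid
edges between the blobs. A flow thus becomes a periodic flow on the grid, which is the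
discrete gradient of a height function `h` on the unit squares, and the capacity bound says that
`h` oscillates by at most `1` around every blob.

Let the class of the flow be `k • c` with `c` primitive. For `m < k` the height functions
`⌊(h - m) / k⌋` belong to flows of class `c` with values `0, ±1`. The blob of a vertex in the
support of the `m`-th flow has exactly one integer level between its heights, and that level is
`≡ m` modulo `k`; hence the `k` supports are vertex-disjoint, and the levels are a potential that
forces every cycle in the supports to be parallel to `c`. Each of the `k` flows
therefore contains a loop of class `n • c` for some `n > 0`. Rounding the unit flow along this loop
with `n` in the place of `k` yields a multiple of the same flow with values `0, ±1` and class `c`,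
so `n = 1`. The sum of the `k` disjoint loops is the required flow.
-/

/-! ### Flows and heights on the square grid -/

namespace SquareGrid

/-- The four unit steps of the square grid, in counterclockwise order. -/
def step : Fin 4 → ℤ × ℤ := ![(1, 0), (0, 1), (-1, 0), (0, -1)]

/-- The unit squares around the origin, each named by its lower left corner; `corner q` lies to the
left of the edge from the origin to `step q`. -/
def corner : Fin 4 → ℤ × ℤ := ![(0, 0), (-1, 0), (-1, -1), (0, -1)]

/-- An oriented edge of the square grid, given by its starting point and its direction. -/
abbrev Edge := (ℤ × ℤ) × Fin 4

/-- The end point of an oriented edge. -/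
def head (e : Edge) : ℤ × ℤ := e.1 + step e.2

/-- The same edge with the opposite orientation. -/
def reverse (e : Edge) : Edge := (head e, e.2 + 2)

/-- The unit square to the left of an oriented edge, named by its lower left corner. -/
def left (e : Edge) : ℤ × ℤ := e.1 + corner e.2

/-- The unit square to the right of an oriented edge, named by its lower left corner. -/
def right (e : Edge) : ℤ × ℤ := e.1 + corner (e.2 + 3)

lemma head_reverse (e : Edge) : head (reverse e) = e.1 := by
  have h : ∀ q, step q + step (q + 2) = 0 := by decide
  rw [head, reverse, head, add_assoc, h, add_zero]

lemma reverse_reverse (e : Edge) : reverse (reverse e) = e := by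
  have h : ∀ q : Fin 4, q + 2 + 2 = q := by decide
  exact Prod.ext (head_reverse e) (h e.2)

lemma reverse_involutive : Function.Involutive reverse := reverse_reverse

lemma head_ne (e : Edge) : head e ≠ e.1 := by
  have h : ∀ q, step q ≠ 0 := by decide
  simpa [head] using h e.2

lemma reverse_ne (e : Edge) : reverse e ≠ e := fun h => head_ne e (congrArg Prod.fst h)

lemma left_reverse (e : Edge) : left (reverse e) = right e := by
  have h : ∀ q, step q + corner (q + 2) = corner (q + 3) := by decide
  rw [left, right, reverse, head, add_assoc, h]

lemma right_reverse (e : Edge) : right (reverse e) = left e := by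
  rw [← left_reverse, reverse_reverse]

lemma head_add (e : Edge) (a : ℤ × ℤ) : head (e + (a, 0)) = head e + a := by
  simp [head, add_right_comm]

lemma reverse_add (e : Edge) (a : ℤ × ℤ) : reverse (e + (a, 0)) = reverse e + (a, 0) := by
  simp [reverse, head_add]

lemma left_add (e : Edge) (a : ℤ × ℤ) : left (e + (a, 0)) = left e + a := by
  simp [left, add_right_comm]

lemma right_add (e : Edge) (a : ℤ × ℤ) : right (e + (a, 0)) = right e + a := by
  simp [right, add_right_comm]

section Height

variable {A : Type*} [AddCommGroup A]

/-- Antisymmetry of a function on the oriented edges of the grid. -/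
def IsAntisymm (f : Edge → A) : Prop := ∀ e, f (reverse e) = -f e

/-- The flow on the grid with height function `h` on the unit squares. -/
def jump (h : ℤ × ℤ → A) (e : Edge) : A := h (left e) - h (right e)

lemma isAntisymm_jump (h : ℤ × ℤ → A) : IsAntisymm (jump h) := fun e => by
  rw [jump, jump, left_reverse, right_reverse, neg_sub]

lemma sum_jump (h : ℤ × ℤ → A) (x : ℤ × ℤ) : ∑ q, jump h (x, q) = 0 := by
  simp only [jump, Finset.sum_sub_distrib]
  exact sub_eq_zero.2 (Equiv.sum_comp (Equiv.addRight (3 : Fin 4)) fun q => h (left (x, q))).symm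

lemma IsAntisymm.ext {f g : Edge → A} (hf : IsAntisymm f) (hg : IsAntisymm g)
    (h0 : ∀ x, f (x, 0) = g (x, 0)) (h1 : ∀ x, f (x, 1) = g (x, 1)) : f = g := by
  have key : ∀ q, (∀ x, f (x, q) = g (x, q)) → ∀ x, f (x, q + 2) = g (x, q + 2) := by
    intro q hq x
    have hdir : reverse (x, q + 2) = (head (x, q + 2), q) :=
      Prod.ext rfl (congrArg Prod.snd (reverse_reverse (x, q)) : q + 2 + 2 = q)
    exact neg_injective (by rw [← hf, ← hg, hdir, hq])
  ext ⟨x, q⟩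
  fin_cases q
  exacts [h0 x, h1 x, key 0 h0 x, key 1 h1 x]

lemma exists_antidifference (g : ℤ → A) : ∃ G : ℤ → A, ∀ n, G (n + 1) - G n = g n := by
  refine ⟨fun n => match n with
    | Int.ofNat k => ∑ i ∈ Finset.range k, g i
    | Int.negSucc k => -∑ i ∈ Finset.range (k + 1), g (Int.negSucc i), ?_⟩
  rintro (k | _ | k)
  · exact sub_eq_of_eq_add' (Finset.sum_range_succ _ k)
  · change ∑ i ∈ Finset.range 0, g i - -∑ i ∈ Finset.range 1, g (Int.negSucc i) = _
    simp
  · change -∑ i ∈ Finset.range (k + 1), g (Int.negSucc i)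
      - -∑ i ∈ Finset.range (k + 1 + 1), g (Int.negSucc i) = _
    rw [Finset.sum_range_succ _ (k + 1)]
    abel

lemma eq_zero_of_difference_eq_zero {G : ℤ → A} (h : ∀ n, G (n + 1) - G n = 0) (h0 : G 0 = 0)
    (n : ℤ) : G n = 0 := by
  have hper : Function.Periodic G 1 := fun n => sub_eq_zero.1 (h n)
  simpa [h0] using hper.int_mul_eq n

lemma exists_antidifference₂ {u v : ℤ → ℤ → A}
    (huv : ∀ a b, u (a + 1) b - u a b = v a (b + 1) - v a b) :
    ∃ H : ℤ → ℤ → A, (∀ a b, H a (b + 1) - H a b = u a b) ∧ ∀ a b, H (a + 1) b - H a b = v a b := by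
  obtain ⟨P, hP⟩ := exists_antidifference fun a => v a 0
  choose Q hQ using fun a => exists_antidifference (u a)
  refine ⟨fun a b => P a + (Q a b - Q a 0), fun a b => by simpa using hQ a b, fun a b => ?_⟩
  refine sub_eq_zero.1 (eq_zero_of_difference_eq_zero
    (G := fun b => P (a + 1) + (Q (a + 1) b - Q (a + 1) 0) - (P a + (Q a b - Q a 0)) - v a b)
    (fun b => ?_) ?_ b)
  · have h := huv a b
    rw [← hQ, ← hQ] at h
    rw [← sub_eq_zero.2 h]
    abel
  · simp [hP]

lemma exists_jump_eq {f : Edge → A} (hf : IsAntisymm f) (hdiv : ∀ x, ∑ q, f (x, q) = 0) :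
    ∃ h, jump h = f := by
  have hdiv' (a b : ℤ) : f ((a, b), 0) + f ((a, b), 1) - f ((a - 1, b), 0) - f ((a, b - 1), 1)
      = 0 := by
    have h2 := hf ((a - 1, b), 0)
    have h3 := hf ((a, b - 1), 1)
    simp only [reverse, head, step, Matrix.cons_val_zero, Prod.mk_add_mk, sub_add_cancel, add_zero,
      zero_add, Matrix.cons_val_one] at h2 h3
    rw [← hdiv (a, b), Fin.sum_univ_four, h2, show (3 : Fin 4) = 1 + 2 from rfl, h3]
    abel
  obtain ⟨H, hu, hv⟩ := exists_antidifference₂ (u := fun a b => f ((a, b + 1), 0))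
    (v := fun a b => -f ((a + 1, b), 1)) (fun a b => by
      have h := hdiv' (a + 1) (b + 1)
      simp only [add_sub_cancel_right] at h
      rw [← sub_eq_zero, ← h]
      abel)
  refine ⟨fun s => H s.1 s.2, (isAntisymm_jump _).ext hf ?_ ?_⟩
  · rintro ⟨a, b⟩
    have h := hu a (b - 1)
    simp only [sub_add_cancel] at h
    rw [← h]
    simp [jump, left, right, corner, sub_eq_add_neg]
  · rintro ⟨a, b⟩
    have h := hv (a - 1) b
    simp only [sub_add_cancel] at h
    rw [← neg_eq_iff_eq_neg.2 h]
    have e : (1 : Fin 4) + 3 = 0 := rfl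
    simp [jump, left, right, e, corner, sub_eq_add_neg]

lemma eq_of_jump_eq_zero {h : ℤ × ℤ → A} (h0 : ∀ e, jump h e = 0) (s t : ℤ × ℤ) : h s = h t := by
  have hper1 (b : ℤ) : Function.Periodic (fun a => h (a, b)) 1 := fun a => by
    have e : (1 : Fin 4) + 3 = 0 := rfl
    have hj : h (a, b) - h (a + 1, b) = 0 := by
      simpa [jump, left, right, e, corner] using h0 ((a + 1, b), 1)
    exact (sub_eq_zero.1 hj).symm
  have hper2 (a : ℤ) : Function.Periodic (fun b => h (a, b)) 1 := fun b => by
    simpa [jump, left, right, corner, sub_eq_zero] using h0 ((a, b + 1), 0)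
  have hconst (s : ℤ × ℤ) : h s = h (0, 0) := by
    have h1 := (hper1 s.2).int_mul_eq s.1
    have h2 := (hper2 0).int_mul_eq s.2
    simp only [Int.cast_id, mul_one] at h1 h2
    exact h1.trans h2
  rw [hconst s, hconst t]

/-- The height functions of the `N`-periodic flows: they are periodic up to the additive constants
`ℓ a`, the periods of the flow. -/
def IsQuasiPeriodic (N : ℕ) (h : ℤ × ℤ → A) (ℓ : ℤ × ℤ →+ A) : Prop :=
  ∀ s a, h (s + N • a) = h s + ℓ a

lemma IsQuasiPeriodic.jump_add {N : ℕ} {h : ℤ × ℤ → A} {ℓ : ℤ × ℤ →+ A}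
    (hh : IsQuasiPeriodic N h ℓ) (e : Edge) (a : ℤ × ℤ) : jump h (e + (N • a, 0)) = jump h e := by
  rw [jump, left_add, right_add, hh, hh, add_sub_add_right_eq_sub, jump]

lemma exists_isQuasiPeriodic {N : ℕ} {h : ℤ × ℤ → A}
    (hh : ∀ e a, jump h (e + (N • a, 0)) = jump h e) : ∃ ℓ, IsQuasiPeriodic N h ℓ := by
  have key (s a : ℤ × ℤ) : h (s + N • a) - h s = h (0 + N • a) - h 0 :=
    eq_of_jump_eq_zero (h := fun s => h (s + N • a) - h s) (fun e => by
      rw [← sub_eq_zero.2 (hh e a)]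
      simp only [jump, left_add, right_add]
      abel) s 0
  refine ⟨AddMonoidHom.mk' (fun a => h (0 + N • a) - h 0) fun a b => ?_, fun s a => ?_⟩
  · rw [← key (N • a) b, ← sub_add_sub_cancel (h (0 + N • (a + b))) (h (N • a)) (h 0), smul_add]
    simp only [zero_add]
    abel
  · rw [AddMonoidHom.mk'_apply, ← key s a, add_sub_cancel]

end Height

/-- The oriented edges that leave a finite set of grid points. -/
def boundary (B : Finset (ℤ × ℤ)) : Finset Edge :=
  (B ×ˢ Finset.univ).filter fun e => head e ∉ B

lemma mem_boundary {B : Finset (ℤ × ℤ)} {e : Edge} : e ∈ boundary B ↔ e.1 ∈ B ∧ head e ∉ B := by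
  simp [boundary]

lemma IsAntisymm.sum_boundary {A : Type*} [AddCommGroup A] {f : Edge → A} (hf : IsAntisymm f)
    {B : Finset (ℤ × ℤ)} (hdiv : ∀ x ∈ B, ∑ q, f (x, q) = 0) : ∑ e ∈ boundary B, f e = 0 := by
  have hinner : ∑ e ∈ (B ×ˢ Finset.univ).filter (fun e : Edge => head e ∈ B), f e = 0 := by
    refine Finset.sum_involution (fun e _ => reverse e) (fun e _ => by rw [hf, add_neg_cancel])
      (fun e _ _ => reverse_ne e) (fun e he => ?_) fun e _ => reverse_reverse e
    simp only [Finset.mem_filter, Finset.mem_product, Finset.mem_univ, and_true] at he ⊢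
    exact ⟨he.2, head_reverse e ▸ he.1⟩
  have hall := Finset.sum_filter_add_sum_filter_not (B ×ˢ Finset.univ)
    (fun e : Edge => head e ∈ B) f
  rwa [hinner, zero_add, Finset.sum_product, Finset.sum_eq_zero hdiv] at hall

/-- The total absolute flow through the edges that leave `B`. -/
def boundaryFlux (f : Edge → ℝ) (B : Finset (ℤ × ℤ)) : ℝ := ∑ e ∈ boundary B, |f e|

lemma boundaryFlux_singleton (f : Edge → ℝ) (y : ℤ × ℤ) :
    boundaryFlux f {y} = ∑ q, |f (y, q)| := by
  have h : boundary {y} = {y} ×ˢ Finset.univ := by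
    ext e
    simp only [mem_boundary, Finset.mem_singleton, Finset.mem_product, Finset.mem_univ, and_true]
    exact and_iff_left_of_imp fun h => h ▸ head_ne e
  rw [boundaryFlux, h, Finset.sum_product, Finset.sum_singleton]

lemma boundaryFlux_add_le_boundaryFlux_insert {f : Edge → ℝ} (hf : IsAntisymm f)
    {B : Finset (ℤ × ℤ)} {e₀ : Edge} (he₀ : head e₀ ∉ B)
    (h0 : ∀ e, e.1 ∈ B → head e = head e₀ → e ≠ e₀ → f e = 0) :
    boundaryFlux f B + boundaryFlux f {head e₀}
      ≤ boundaryFlux f (insert (head e₀) B) + 2 * |f e₀| := by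
  have hdisj : Disjoint (boundary B) (boundary {head e₀}) := Finset.disjoint_left.2 fun e h h' =>
    he₀ (Finset.mem_singleton.1 (mem_boundary.1 h').1 ▸ (mem_boundary.1 h).1)
  have hsub : (boundary B ∪ boundary {head e₀}).filter (fun e => |f e| ≠ 0)
      ⊆ boundary (insert (head e₀) B) ∪ {e₀, reverse e₀} := by
    intro e he
    simp only [Finset.mem_filter, Finset.mem_union, mem_boundary, Finset.mem_insert,
      Finset.mem_singleton, abs_ne_zero] at he ⊢
    obtain ⟨⟨h1, h2⟩ | ⟨h1, h2⟩, hfe⟩ := he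
    · by_cases h : head e = head e₀
      · exact .inr (.inl (by_contra fun hne => hfe (h0 e h1 h hne)))
      · exact .inl ⟨.inr h1, not_or.2 ⟨h, h2⟩⟩
    · by_cases h : head e ∈ B
      · have hrev : reverse e = e₀ := by
          by_contra hne
          exact hfe (neg_eq_zero.1 (hf e ▸ h0 _ h ((head_reverse e).trans h1) hne))
        exact .inr (.inr (hrev ▸ (reverse_reverse e).symm))
      · exact .inl ⟨.inl h1, not_or.2 ⟨h2, h⟩⟩
  calc boundaryFlux f B + boundaryFlux f {head e₀}
      = ∑ e ∈ (boundary B ∪ boundary {head e₀}).filter (fun e => |f e| ≠ 0), |f e| := by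
        rw [Finset.sum_filter_ne_zero, Finset.sum_union hdisj, boundaryFlux, boundaryFlux]
    _ ≤ ∑ e ∈ boundary (insert (head e₀) B) ∪ {e₀, reverse e₀}, |f e| :=
        Finset.sum_le_sum_of_subset_of_nonneg hsub fun _ _ _ => abs_nonneg _
    _ ≤ ∑ e ∈ boundary (insert (head e₀) B), |f e| + ∑ e ∈ {e₀, reverse e₀}, |f e| := by
        rw [← Finset.sum_union_inter]
        exact le_add_of_nonneg_right (Finset.sum_nonneg fun _ _ => abs_nonneg _)
    _ = boundaryFlux f (insert (head e₀) B) + 2 * |f e₀| := by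
        rw [Finset.sum_pair (reverse_ne e₀).symm, hf, abs_neg, two_mul, boundaryFlux]

/-- The heights of any two squares that touch `B` differ by at most half of the boundary flux. -/
def RangeBound (h : ℤ × ℤ → ℝ) (B : Finset (ℤ × ℤ)) : Prop :=
  ∀ d e : Edge, d.1 ∈ B → e.1 ∈ B → |h (left d) - h (left e)| ≤ boundaryFlux (jump h) B / 2

lemma RangeBound.abs_sub_right_le {h : ℤ × ℤ → ℝ} {B : Finset (ℤ × ℤ)} (hB : RangeBound h B)
    {d e : Edge} (hd : d.1 ∈ B) (he : e.1 ∈ B) :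
    |h (left d) - h (right e)| ≤ boundaryFlux (jump h) B / 2 :=
  hB d (e.1, e.2 + 3) hd he

lemma abs_sub_le_sum_cyclic (g : Fin 4 → ℝ) (q p : Fin 4) :
    |g q - g p| ≤ (∑ i, |g i - g (i + 3)|) / 2 := by
  have h0 := abs_le.1 (le_refl |g 0 - g 3|)
  have h1 := abs_le.1 (le_refl |g 1 - g 0|)
  have h2 := abs_le.1 (le_refl |g 2 - g 1|)
  have h3 := abs_le.1 (le_refl |g 3 - g 2|)
  rw [Fin.sum_univ_four]
  simp only [show (1 : Fin 4) + 3 = 0 from rfl, show (2 : Fin 4) + 3 = 1 from rfl,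
    show (3 : Fin 4) + 3 = 2 from rfl, zero_add]
  fin_cases q <;> fin_cases p <;> refine abs_le.2 ⟨?_, ?_⟩ <;>
    simp only [Fin.zero_eta, Fin.mk_one, Fin.reduceFinMk] <;> linarith

lemma rangeBound_singleton (h : ℤ × ℤ → ℝ) (y : ℤ × ℤ) : RangeBound h {y} := by
  rintro ⟨x, q⟩ ⟨z, p⟩ hx hz
  obtain rfl : x = y := Finset.mem_singleton.1 hx
  obtain rfl : z = x := Finset.mem_singleton.1 hz
  rw [boundaryFlux_singleton]
  exact abs_sub_le_sum_cyclic (fun q => h (left (z, q))) q p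

lemma abs_sub_le_of_abs_sub_le {u w a b r s t : ℝ} (hua : |u - a| ≤ r) (hub : |u - b| ≤ r)
    (hwa : |w - a| ≤ s) (hwb : |w - b| ≤ s) (ht : r + s ≤ t + |a - b|) : |u - w| ≤ t := by
  rw [abs_le] at *
  rcases abs_cases (a - b) with ⟨h, -⟩ | ⟨h, -⟩ <;> rw [h] at ht <;> constructor <;> linarith

lemma RangeBound.insert {h : ℤ × ℤ → ℝ} {B : Finset (ℤ × ℤ)} {e₀ : Edge} (hB : RangeBound h B)
    (hx : e₀.1 ∈ B) (hy : head e₀ ∉ B)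
    (h0 : ∀ e, e.1 ∈ B → head e = head e₀ → e ≠ e₀ → jump h e = 0) :
    RangeBound h (insert (head e₀) B) := by
  have hflux := boundaryFlux_add_le_boundaryFlux_insert (isAntisymm_jump h) hy h0
  have hY := rangeBound_singleton h (head e₀)
  have hrev : (reverse e₀).1 ∈ ({head e₀} : Finset _) := Finset.mem_singleton_self _
  have hleft {d : Edge} (hd : d.1 ∈ ({head e₀} : Finset _)) :
      |h (left d) - h (left e₀)| ≤ boundaryFlux (jump h) {head e₀} / 2 :=
    right_reverse e₀ ▸ hY.abs_sub_right_le hd hrev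
  have hright {d : Edge} (hd : d.1 ∈ ({head e₀} : Finset _)) :
      |h (left d) - h (right e₀)| ≤ boundaryFlux (jump h) {head e₀} / 2 :=
    left_reverse e₀ ▸ hY d (reverse e₀) hd hrev
  have hjumpB : |jump h e₀| ≤ boundaryFlux (jump h) B / 2 := hB.abs_sub_right_le hx hx
  have hjumpY : |jump h e₀| ≤ boundaryFlux (jump h) {head e₀} / 2 := by
    rw [jump, abs_sub_comm, ← left_reverse]
    exact hleft hrev
  have hmix {d e : Edge} (hd : d.1 ∈ B) (he : e.1 ∈ ({head e₀} : Finset _)) :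
      |h (left d) - h (left e)| ≤ boundaryFlux (jump h) (Insert.insert (head e₀) B) / 2 :=
    abs_sub_le_of_abs_sub_le (hB d e₀ hd hx) (hB.abs_sub_right_le hd hx) (hleft he) (hright he)
      (by rw [jump] at hflux; linarith)
  intro d e hd he
  rw [Finset.insert_eq, Finset.mem_union] at hd he
  rcases hd with hd | hd <;> rcases he with he | he
  · linarith [hY d e hd he]
  · exact abs_sub_comm (h (left d)) _ ▸ hmix he hd
  · exact hmix hd he
  · linarith [hB d e hd he]

section TreeFlow

variable {A : Type*} [AddCommGroup A]

/-- The antisymmetric function with value `c` on the edge `e` that vanishes on all other edges. -/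
def edgeFlow (e : Edge) (c : A) : Edge → A := Pi.single e c - Pi.single (reverse e) c

lemma isAntisymm_edgeFlow (e : Edge) (c : A) : IsAntisymm (edgeFlow e c) := fun d => by
  have h (a b : Edge) :
      (Pi.single a c : Edge → A) (reverse b) = (Pi.single (reverse a) c : Edge → A) b := by
    simp only [Pi.single_apply, reverse_involutive.eq_iff]
  simp only [edgeFlow, Pi.sub_apply, h, reverse_reverse, neg_sub]

lemma edgeFlow_of_ne {d e : Edge} (h : d ≠ e) (h' : d ≠ reverse e) (c : A) :
    edgeFlow e c d = 0 := by
  rw [edgeFlow, Pi.sub_apply, Pi.single_eq_of_ne h, Pi.single_eq_of_ne h', sub_zero]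

lemma sum_edgeFlow (e : Edge) (c : A) (x : ℤ × ℤ) :
    ∑ q, edgeFlow e c (x, q) = (if x = e.1 then c else 0) - if x = head e then c else 0 := by
  have h (a : Edge) : ∑ q, (Pi.single a c : Edge → A) (x, q) = if x = a.1 then c else 0 := by
    simp [Pi.single_apply, Prod.ext_iff, ite_and]
  simp only [edgeFlow, Pi.sub_apply, Finset.sum_sub_distrib, h, reverse]

/-- Antisymmetric functions carried by a spanning tree of a finite set of grid points that is built
by adding one neighbour at a time. -/
inductive TreeFlow : Finset (ℤ × ℤ) → (Edge → A) → Prop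
  | single (x) : TreeFlow {x} 0
  | insert {B F e} (hF : TreeFlow B F) (hx : e.1 ∈ B) (hy : head e ∉ B) (c) :
      TreeFlow (insert (head e) B) (F + edgeFlow e c)

lemma TreeFlow.isAntisymm {B : Finset (ℤ × ℤ)} {F : Edge → A} (hF : TreeFlow B F) :
    IsAntisymm F := by
  induction hF with
  | single => simp [IsAntisymm]
  | @insert _ F e _ _ _ c ih =>
    intro d
    rw [Pi.add_apply, Pi.add_apply, ih, isAntisymm_edgeFlow, neg_add]

lemma TreeFlow.mem_of_ne_zero {B : Finset (ℤ × ℤ)} {F : Edge → A} (hF : TreeFlow B F) {d : Edge}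
    (hd : F d ≠ 0) : d.1 ∈ B ∧ head d ∈ B := by
  induction hF with
  | single => simp at hd
  | @insert B F e _ hx _ c ih =>
    by_cases h : F d = 0
    · by_cases h1 : d = e
      · rw [h1]
        exact ⟨Finset.mem_insert_of_mem hx, Finset.mem_insert_self _ _⟩
      by_cases h2 : d = reverse e
      · rw [h2, head_reverse]
        exact ⟨Finset.mem_insert_self _ _, Finset.mem_insert_of_mem hx⟩
      · exact absurd (by rw [Pi.add_apply, h, edgeFlow_of_ne h1 h2, add_zero]) hd
    · exact (ih h).imp Finset.mem_insert_of_mem Finset.mem_insert_of_mem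

lemma TreeFlow.rangeBound {B : Finset (ℤ × ℤ)} {F : Edge → ℝ} (hF : TreeFlow B F)
    {h : ℤ × ℤ → ℝ} (hh : ∀ e, e.1 ∈ B → head e ∈ B → jump h e = F e) : RangeBound h B := by
  induction hF with
  | single x => exact rangeBound_singleton h x
  | @insert B F e hF hx hy c ih =>
    refine (ih fun d h1 h2 => ?_).insert hx hy fun d h1 h2 hne => ?_
    · rw [hh d (Finset.mem_insert_of_mem h1) (Finset.mem_insert_of_mem h2), Pi.add_apply,
        edgeFlow_of_ne (fun h => hy (by rwa [h] at h2)) (fun h => hy (by rwa [h] at h1)), add_zero]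
    · have hFd : F d = 0 := by_contra fun h => hy (h2 ▸ (hF.mem_of_ne_zero h).2)
      rw [hh d (Finset.mem_insert_of_mem h1) (h2 ▸ Finset.mem_insert_self _ _), Pi.add_apply, hFd,
        edgeFlow_of_ne hne (fun h => hy (by rwa [h] at h1)), add_zero]

/-- Finite connected sets of grid points, built by adding one neighbour at a time. -/
inductive GridTree : Finset (ℤ × ℤ) → Prop
  | single (x) : GridTree {x}
  | insert {B} {e : Edge} (hB : GridTree B) (hx : e.1 ∈ B) (hy : head e ∉ B) :
      GridTree (insert (head e) B)

lemma GridTree.exists_treeFlow {B : Finset (ℤ × ℤ)} (hB : GridTree B) :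
    ∀ b : ℤ × ℤ → A, ∑ x ∈ B, b x = 0 → ∃ F, TreeFlow B F ∧ ∀ x ∈ B, ∑ q, F (x, q) = b x := by
  induction hB with
  | single x => exact fun b hb => ⟨0, .single x, by simpa using hb.symm⟩
  | @insert B e _ hx hy ih =>
    intro b hb
    rw [Finset.sum_insert hy] at hb
    obtain ⟨F, hF, hFb⟩ := ih (b + Pi.single e.1 (b (head e))) (by
      simpa [Finset.sum_add_distrib, Finset.sum_pi_single, hx, add_comm] using hb)
    refine ⟨_, hF.insert hx hy (-b (head e)), fun x hxB => ?_⟩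
    simp only [Pi.add_apply, Finset.sum_add_distrib, sum_edgeFlow]
    rcases Finset.mem_insert.1 hxB with rfl | hxB
    · have hzero : ∑ q, F (head e, q) = 0 := Finset.sum_eq_zero fun q _ =>
        by_contra fun h => hy (hF.mem_of_ne_zero h).1
      rw [hzero, if_neg (head_ne e), if_pos rfl]
      simp
    · rw [hFb x hxB, if_neg (fun h : x = head e => hy (h ▸ hxB))]
      by_cases h : x = e.1 <;> simp [h]

end TreeFlow

/-- The grid point `z` can be reached from `y` by unit steps into points of `S`. -/
def Reachable (S : Set (ℤ × ℤ)) : ℤ × ℤ → ℤ × ℤ → Prop :=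
  Relation.ReflTransGen fun y z => z ∈ S ∧ ∃ q, head (y, q) = z

lemma Reachable.mono {S T : Set (ℤ × ℤ)} (hST : S ⊆ T) {y z : ℤ × ℤ} (h : Reachable S y z) :
    Reachable T y z :=
  Relation.ReflTransGen.mono (fun _ _ hyz => ⟨hST hyz.1, hyz.2⟩) _ _ h

lemma GridTree.of_reachable {B : Finset (ℤ × ℤ)} {x₀ : ℤ × ℤ} (hx₀ : x₀ ∈ B)
    (hB : ∀ x ∈ B, Reachable B x₀ x) : GridTree B := by
  classical
  obtain ⟨T, hT, hmax⟩ := (B.powerset.filter fun T => GridTree T ∧ x₀ ∈ T).exists_max_image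
    Finset.card ⟨{x₀}, by simp [hx₀, GridTree.single]⟩
  simp only [Finset.mem_filter, Finset.mem_powerset] at hT hmax
  obtain ⟨hTB, hT, hx₀T⟩ := hT
  suffices h : ∀ x ∈ B, x ∈ T by rwa [Finset.Subset.antisymm (fun x => h x) hTB]
  intro x hx
  have hreach := hB x hx
  clear hx
  induction hreach with
  | refl => exact hx₀T
  | @tail y z _ hyz ih =>
    obtain ⟨hzB, q, rfl⟩ := hyz
    by_contra hz
    have hcard := hmax (Insert.insert (head (y, q)) T) ⟨Finset.insert_subset hzB hTB,
      hT.insert ih hz, Finset.mem_insert_of_mem hx₀T⟩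
    rw [Finset.card_insert_of_notMem hz] at hcard
    lia

lemma Reachable.mem {S : Set (ℤ × ℤ)} {x y : ℤ × ℤ} (h : Reachable S x y) (hx : x ∈ S) :
    y ∈ S := by
  rcases h.cases_tail with rfl | ⟨_, -, hy⟩
  exacts [hx, hy.1]

lemma Reachable.exists_first_entry {S T : Set (ℤ × ℤ)} {x y : ℤ × ℤ} (h : Reachable S x y)
    (hx : x ∉ T) (hy : y ∈ T) : ∃ e : Edge, Reachable (S \ T) x e.1 ∧ head e ∈ T := by
  suffices key : Reachable (S \ T) x y ∨ ∃ e : Edge, Reachable (S \ T) x e.1 ∧ head e ∈ T by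
    refine key.resolve_left fun h => ?_
    rcases h.cases_tail with rfl | ⟨_, -, h⟩
    exacts [hx hy, h.1.2 hy]
  clear hy
  induction h with
  | refl => exact Or.inl .refl
  | @tail y z _ hyz ih =>
    obtain ⟨hz, q, rfl⟩ := hyz
    refine ih.elim (fun hxy => ?_) Or.inr
    by_cases hT : head (y, q) ∈ T
    · exact Or.inr ⟨(y, q), hxy, hT⟩
    · exact Or.inl (hxy.tail ⟨⟨hz, hT⟩, q, rfl⟩)

lemma reflTransGen_of_ordConnected {s : Set ℤ} (hs : s.OrdConnected) {a b : ℤ} (ha : a ∈ s)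
    (hb : b ∈ s) :
    Relation.ReflTransGen (fun x y => y ∈ s ∧ (y = x + 1 ∨ y = x - 1)) a b := by
  refine reflTransGen_of_succ _ (fun i hi => ?_) fun i hi => ?_
  · exact ⟨hs.out ha hb ⟨hi.1.trans (Order.le_succ i), Order.succ_le_of_lt hi.2⟩,
      Or.inl (Order.succ_eq_add_one i)⟩
  · refine ⟨hs.out hb ha ⟨hi.1, hi.2.le⟩, Or.inr ?_⟩
    rw [Order.succ_eq_add_one, add_sub_cancel_right]

lemma reachable_prod {s t : Set ℤ} (hs : s.OrdConnected) (ht : t.OrdConnected) {x y : ℤ × ℤ}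
    (hx : x ∈ s ×ˢ t) (hy : y ∈ s ×ˢ t) : Reachable (s ×ˢ t) x y := by
  have h1 : Reachable (s ×ˢ t) (x.1, x.2) (y.1, x.2) :=
    (reflTransGen_of_ordConnected hs hx.1 hy.1).lift (fun a => (a, x.2)) fun a b hab =>
      ⟨⟨hab.1, hx.2⟩, hab.2.elim (fun h => ⟨0, by simp [head, step, h]⟩)
        fun h => ⟨2, by simp [head, step, h, sub_eq_add_neg]⟩⟩
  have h2 : Reachable (s ×ˢ t) (y.1, x.2) (y.1, y.2) :=
    (reflTransGen_of_ordConnected ht hx.2 hy.2).lift (fun b => (y.1, b)) fun a b hab =>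
      ⟨⟨hy.1, hab.1⟩, hab.2.elim (fun h => ⟨1, by simp [head, step, h]⟩)
        fun h => ⟨3, by simp [head, step, h, sub_eq_add_neg]⟩⟩
  exact h1.trans h2

section Torus

variable {N : ℕ}

/-- A fundamental domain of the translations by `N • ℤ²`. -/
noncomputable def box (N : ℕ) : Finset (ℤ × ℤ) := Finset.Ico 0 (N : ℤ) ×ˢ Finset.Ico 0 (N : ℤ)

/-- The representative in `box N` of a grid point modulo `N • ℤ²`. -/
def wrap (N : ℕ) (x : ℤ × ℤ) : ℤ × ℤ := (x.1 % N, x.2 % N)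

lemma wrap_mem_box [NeZero N] (x : ℤ × ℤ) : wrap N x ∈ box N := by
  have hN : 0 < (N : ℤ) := mod_cast NeZero.pos N
  simp [box, wrap, Int.emod_nonneg _ hN.ne', Int.emod_lt_of_pos _ hN]

lemma wrap_of_mem_box {x : ℤ × ℤ} (hx : x ∈ box N) : wrap N x = x := by
  simp only [box, Finset.mem_product, Finset.mem_Ico] at hx
  exact Prod.ext (Int.emod_eq_of_lt hx.1.1 hx.1.2) (Int.emod_eq_of_lt hx.2.1 hx.2.2)

lemma wrap_add_smul (x a : ℤ × ℤ) : wrap N (x + N • a) = wrap N x := by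
  simp [wrap]

lemma exists_eq_add_smul_of_wrap_eq {x y : ℤ × ℤ} (h : wrap N x = wrap N y) :
    ∃ a : ℤ × ℤ, y = x + N • a := by
  simp only [wrap, Prod.mk.injEq] at h
  obtain ⟨a, ha⟩ : (N : ℤ) ∣ y.1 - x.1 := Int.ModEq.dvd h.1
  obtain ⟨b, hb⟩ : (N : ℤ) ∣ y.2 - x.2 := Int.ModEq.dvd h.2
  exact ⟨(a, b), Prod.ext (by simp [← ha]) (by simp [← hb])⟩

lemma exists_wrap_eq (x : ℤ × ℤ) : ∃ a : ℤ × ℤ, wrap N x = x + N • a :=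
  exists_eq_add_smul_of_wrap_eq (by simp [wrap])

/-- The representative of a grid edge that starts in `box N`. -/
def wrapEdge (N : ℕ) (e : Edge) : Edge := (wrap N e.1, e.2)

lemma wrapEdge_add (e : Edge) (a : ℤ × ℤ) : wrapEdge N (e + (N • a, 0)) = wrapEdge N e :=
  Prod.ext (wrap_add_smul e.1 a) (add_zero e.2)

lemma exists_eq_add_of_wrapEdge_eq {d e : Edge} (h : wrapEdge N d = wrapEdge N e) :
    ∃ a : ℤ × ℤ, e = d + (N • a, 0) := by
  obtain ⟨hbase, hdir⟩ := Prod.mk.inj h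
  obtain ⟨a, ha⟩ := exists_eq_add_smul_of_wrap_eq hbase
  exact ⟨a, Prod.ext ha (by simp [hdir])⟩

lemma exists_wrapEdge_eq (e : Edge) : ∃ a : ℤ × ℤ, wrapEdge N e = e + (N • a, 0) := by
  obtain ⟨a, ha⟩ := exists_wrap_eq (N := N) e.1
  exact ⟨a, Prod.ext ha (add_zero e.2).symm⟩

lemma sum_box_add [NeZero N] {R : Type*} [AddCommMonoid R] {g : ℤ × ℤ → R}
    (hg : ∀ x a, g (x + N • a) = g x) (c : ℤ × ℤ) :
    ∑ x ∈ box N, g (x + c) = ∑ x ∈ box N, g x := by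
  refine Finset.sum_nbij' (fun x => wrap N (x + c)) (fun x => wrap N (x - c))
    (fun _ _ => wrap_mem_box _) (fun _ _ => wrap_mem_box _) (fun x hx => ?_) (fun x hx => ?_)
    fun x _ => ?_
  · conv_rhs => rw [← wrap_of_mem_box hx]
    simp [wrap]
  · conv_rhs => rw [← wrap_of_mem_box hx]
    simp [wrap]
  · obtain ⟨a, ha⟩ := exists_wrap_eq (N := N) (x + c)
    rw [ha, hg]

lemma sum_box_smul_head_sub [NeZero N] {E : Type*} [AddCommGroup E] [Module ℝ E] {f : Edge → ℝ}
    (hf : IsAntisymm f) (hdiv : ∀ x, ∑ q, f (x, q) = 0)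
    (hfN : ∀ e a, f (e + (N • a, 0)) = f e) {ψ : ℤ × ℤ → E} (hψ : ∀ x a, ψ (x + N • a) = ψ x) :
    ∑ x ∈ box N, ∑ q, f (x, q) • (ψ (head (x, q)) - ψ x) = 0 := by
  have htail : ∑ x ∈ box N, ∑ q, f (x, q) • ψ x = 0 :=
    Finset.sum_eq_zero fun x _ => by rw [← Finset.sum_smul, hdiv, zero_smul]
  have hper (q : Fin 4) (x a : ℤ × ℤ) :
      f (x + N • a, q) • ψ (x + N • a) = f (x, q) • ψ x := by
    have h := hfN (x, q) a
    rw [Prod.mk_add_mk, add_zero] at h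
    rw [hψ, h]
  have hhead : ∑ x ∈ box N, ∑ q, f (x, q) • ψ (head (x, q)) = 0 := by
    calc ∑ x ∈ box N, ∑ q, f (x, q) • ψ (head (x, q))
        = -∑ q, ∑ x ∈ box N, f (x + step q, q + 2) • ψ (x + step q) := by
          have hrev (x : ℤ × ℤ) (q : Fin 4) : f (x + step q, q + 2) = -f (x, q) := hf (x, q)
          rw [Finset.sum_comm]
          simp only [hrev, head, neg_smul, Finset.sum_neg_distrib, neg_neg]
      _ = -∑ q, ∑ x ∈ box N, f (x, q + 2) • ψ x := by
          congr! 2 with q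
          exact sum_box_add (g := fun x => f (x, q + 2) • ψ x) (hper (q + 2)) (step q)
      _ = -∑ q, ∑ x ∈ box N, f (x, q) • ψ x := by
          congr 1
          exact Equiv.sum_comp (Equiv.addRight (2 : Fin 4)) fun q => ∑ x ∈ box N, f (x, q) • ψ x
      _ = 0 := by rw [Finset.sum_comm, htail, neg_zero]
  simp only [smul_sub, Finset.sum_sub_distrib, hhead, htail, sub_zero]

lemma IsQuasiPeriodic.sum_box_jump [NeZero N] {h : ℤ × ℤ → ℝ} {ℓ : ℤ × ℤ →+ ℝ}
    (hh : IsQuasiPeriodic N h ℓ) (q : Fin 4) :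
    ∑ x ∈ box N, jump h (x, q) = N * ℓ (corner q - corner (q + 3)) := by
  have hN : (N : ℝ) ≠ 0 := NeZero.ne _
  let K (s : ℤ × ℤ) : ℝ := h s - ℓ s / N
  have hK (s a : ℤ × ℤ) : K (s + N • a) = K s := by
    simp only [K]
    rw [hh, map_add, map_nsmul, nsmul_eq_mul]
    field_simp
    ring
  have hjump (x : ℤ × ℤ) : jump h (x, q)
      = K (x + corner q) - K (x + corner (q + 3)) + ℓ (corner q - corner (q + 3)) / N := by
    simp only [K, jump, left, right, map_add, map_sub]
    ring
  have hcard : (box N).card = N * N := by simp [box]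
  rw [Finset.sum_congr rfl fun x _ => hjump x, Finset.sum_add_distrib, Finset.sum_sub_distrib,
    sum_box_add hK, sum_box_add hK, sub_self, zero_add, Finset.sum_const, hcard, nsmul_eq_mul]
  push_cast
  field_simp

end Torus

end SquareGrid

/-! ### Flows on torus graphs -/

lemma latticeVec_add (a b : ℤ × ℤ) : latticeVec (a + b) = latticeVec a + latticeVec b := by
  simp [latticeVec]

lemma latticeVec_neg (a : ℤ × ℤ) : latticeVec (-a) = -latticeVec a := by
  simp [latticeVec]

lemma latticeVec_sub (a b : ℤ × ℤ) : latticeVec (a - b) = latticeVec a - latticeVec b := by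
  simp [latticeVec]

lemma latticeVec_zsmul (n : ℤ) (a : ℤ × ℤ) : latticeVec (n • a) = (n : ℝ) • latticeVec a := by
  simp [latticeVec]

lemma latticeVec_nsmul (n : ℕ) (a : ℤ × ℤ) : latticeVec (n • a) = n • latticeVec a := by
  simp [latticeVec]

lemma latticeVec_eq_zero {a : ℤ × ℤ} : latticeVec a = 0 ↔ a = 0 := by
  simp [latticeVec, Prod.ext_iff]

lemma exists_isCoprime_nsmul_eq (a : ℤ × ℤ) :
    ∃ (k : ℕ) (c : ℤ × ℤ), IsCoprime c.1 c.2 ∧ k • c = a := by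
  rcases (Int.gcd a.1 a.2).eq_zero_or_pos with h | h
  · obtain ⟨h1, h2⟩ := Int.gcd_eq_zero_iff.1 h
    exact ⟨0, (1, 0), isCoprime_one_left, by rw [zero_smul]; exact (Prod.ext h1 h2).symm⟩
  · obtain ⟨p, q, hpq, h1, h2⟩ := Int.exists_gcd_one h
    refine ⟨Int.gcd a.1 a.2, (p, q), Int.isCoprime_iff_gcd_eq_one.2 hpq, Prod.ext ?_ ?_⟩
    · simp [h1.symm, mul_comm]
    · simp [h2.symm, mul_comm]

namespace TorusGraph

variable {V D : Type*}

lemma tgt_rev (G : TorusGraph V D) (d : D) : G.tgt (G.rev d) = G.src d := by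
  rw [tgt, G.rev_rev]

lemma sum_comp_rev [Fintype D] (G : TorusGraph V D) {M : Type*} [AddCommMonoid M] (g : D → M) :
    ∑ d, g (G.rev d) = ∑ d, g d :=
  Equiv.sum_comp (Function.Involutive.toPerm G.rev G.rev_rev) g

section Flow

variable [Fintype D] [DecidableEq V] {G : TorusGraph V D} {ω : D → ℝ}

lemma IsFlow.sum_smul_src (hω : G.IsFlow ω) {M : Type*} [AddCommGroup M] [Module ℝ M]
    (φ : V → M) : ∑ d, ω d • φ (G.src d) = 0 := by
  rw [← Finset.sum_fiberwise_of_maps_to fun d hd => Finset.mem_image_of_mem G.src hd]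
  refine Finset.sum_eq_zero fun v _ => ?_
  rw [← zero_smul ℝ (φ v), ← hω.2 v, Finset.sum_smul]
  exact Finset.sum_congr rfl fun d hd => by rw [(Finset.mem_filter.1 hd).2]

lemma IsFlow.sum_smul_sub (hω : G.IsFlow ω) {M : Type*} [AddCommGroup M] [Module ℝ M]
    (φ : V → M) : ∑ d, ω d • (φ (G.tgt d) - φ (G.src d)) = 0 := by
  simp only [smul_sub, Finset.sum_sub_distrib]
  rw [hω.sum_smul_src, sub_zero, ← G.sum_comp_rev]
  simp only [tgt_rev, hω.1, neg_smul, Finset.sum_neg_distrib, hω.sum_smul_src, neg_zero]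

lemma IsFlow.inflow_eq (hω : G.IsFlow ω) (v : V) :
    G.inflow ω v = (∑ d with G.src d = v, |ω d|) / 2 := by
  have hin : G.inflow ω v = ∑ d with G.src d = v, max (-ω d) 0 := by
    rw [inflow, Finset.sum_filter, Finset.sum_filter, ← G.sum_comp_rev]
    simp only [tgt_rev, hω.1]
  have hmax (x : ℝ) : max (-x) 0 = (|x| - x) / 2 := by
    rcases le_total x 0 with h | h
    · rw [max_eq_left (neg_nonneg.2 h), abs_of_nonpos h]; ring
    · rw [max_eq_right (neg_nonpos.2 h), abs_of_nonneg h]; ring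
  simp only [hin, hmax, ← Finset.sum_div, Finset.sum_sub_distrib, hω.2 v, sub_zero]

end Flow

lemma isLinearMap_homologyClass [Fintype D] (G : TorusGraph V D) :
    IsLinearMap ℝ G.homologyClass where
  map_add ω η := by
    simp only [homologyClass, Pi.add_apply, add_smul, Finset.sum_add_distrib, smul_add]
  map_smul a ω := by
    simp only [homologyClass, Pi.smul_apply, smul_assoc, ← Finset.smul_sum]
    exact smul_comm _ _ _

lemma homologyClass_sum [Fintype D] (G : TorusGraph V D) {ι : Type*} (s : Finset ι)
    (ω : ι → D → ℝ) : G.homologyClass (∑ i ∈ s, ω i) = ∑ i ∈ s, G.homologyClass (ω i) :=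
  map_sum (G.isLinearMap_homologyClass.mk' _) ω s

/-- The lattice vector that separates the start of `G.arc d` from the chosen lift of its starting
vertex. -/
noncomputable def startShift (G : TorusGraph V D) (d : D) : ℤ × ℤ := (G.arc_zero d).choose

lemma arc_zero_eq (G : TorusGraph V D) (d : D) :
    G.arc d 0 = G.pos (G.src d) + latticeVec (G.startShift d) :=
  (G.arc_zero d).choose_spec

/-- The translation class of the end of an edge, relative to its start. -/
noncomputable def shift (G : TorusGraph V D) (d : D) : ℤ × ℤ :=
  G.startShift (G.rev d) - G.startShift d

lemma shift_rev (G : TorusGraph V D) (d : D) : G.shift (G.rev d) = -G.shift d := by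
  rw [shift, shift, G.rev_rev, neg_sub]

lemma arc_one_eq (G : TorusGraph V D) (d : D) :
    G.arc d 1 = G.pos (G.tgt d) + latticeVec (G.startShift (G.rev d)) := by
  rw [tgt, ← arc_zero_eq, G.arc_rev, unitInterval.symm_zero]

lemma displacement_eq (G : TorusGraph V D) (d : D) :
    G.displacement d = G.pos (G.tgt d) - G.pos (G.src d) + latticeVec (G.shift d) := by
  rw [displacement, arc_zero_eq, arc_one_eq, shift, latticeVec_sub]
  abel

lemma IsFlow.homologyClass_eq [Fintype D] [DecidableEq V] {G : TorusGraph V D}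
    {ω : D → ℝ} (hω : G.IsFlow ω) :
    G.homologyClass ω = (1 / 2 : ℝ) • ∑ d, ω d • latticeVec (G.shift d) := by
  simp only [homologyClass, G.displacement_eq, smul_add, Finset.sum_add_distrib,
    hω.sum_smul_sub G.pos, zero_add]

/-- The edges that are not contractible loops on the torus. -/
def IsEssential (G : TorusGraph V D) (d : D) : Prop := G.src d ≠ G.tgt d ∨ G.shift d ≠ 0

lemma isEssential_rev {G : TorusGraph V D} {d : D} : G.IsEssential (G.rev d) ↔ G.IsEssential d := by
  rw [IsEssential, IsEssential, tgt_rev, shift_rev, neg_ne_zero, ne_comm]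
  rfl

lemma not_isEssential {G : TorusGraph V D} {d : D} :
    ¬G.IsEssential d ↔ G.src d = G.tgt d ∧ G.shift d = 0 := by
  simp only [IsEssential, not_or, not_not]

section Essential

variable {G : TorusGraph V D} {ω : D → ℝ}

lemma displacement_of_not_isEssential {d : D} (hd : ¬G.IsEssential d) :
    G.displacement d = 0 := by
  obtain ⟨hsrc, hshift⟩ := not_isEssential.1 hd
  rw [G.displacement_eq, hsrc, hshift, sub_self, zero_add, latticeVec_eq_zero]

open Classical in
/-- The part of a flow that runs along essential edges. -/
noncomputable def essentialPart (G : TorusGraph V D) (ω : D → ℝ) (d : D) : ℝ :=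
  if G.IsEssential d then ω d else 0

lemma isEssential_of_essentialPart_ne_zero {d : D} (hd : G.essentialPart ω d ≠ 0) :
    G.IsEssential d :=
  of_not_not fun h => hd (if_neg h)

lemma homologyClass_essentialPart [Fintype D] (G : TorusGraph V D) (ω : D → ℝ) :
    G.homologyClass (G.essentialPart ω) = G.homologyClass ω := by
  refine congrArg (_ • ·) (Finset.sum_congr rfl fun d _ => ?_)
  by_cases hd : G.IsEssential d
  · rw [essentialPart, if_pos hd]
  · rw [displacement_of_not_isEssential hd, smul_zero, smul_zero]

lemma essentialPart_mem_unitFlows [Fintype D] [DecidableEq V] (hω : ω ∈ G.unitFlows) :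
    G.essentialPart ω ∈ G.unitFlows := by
  classical
  refine ⟨⟨fun d => ?_, fun v => ?_⟩, fun v => (Finset.sum_le_sum fun d _ => ?_).trans (hω.2 v)⟩
  · simp only [essentialPart, isEssential_rev, hω.1.1]
    split_ifs <;> simp
  · have hloop : ∑ d with G.src d = v ∧ ¬G.IsEssential d, ω d = 0 := by
      refine Finset.sum_involution (fun d _ => G.rev d)
        (fun d _ => by rw [hω.1.1, add_neg_cancel]) (fun d _ _ => G.rev_ne d) (fun d hd => ?_)
        fun d _ => G.rev_rev d
      simp only [Finset.mem_filter, Finset.mem_univ, true_and] at hd ⊢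
      exact ⟨(not_isEssential.1 hd.2).1.symm.trans hd.1, mt isEssential_rev.1 hd.2⟩
    rw [← hω.1.2 v, ← Finset.sum_filter_add_sum_filter_not {d | G.src d = v} G.IsEssential ω]
    rw [Finset.filter_filter _ (¬G.IsEssential ·), hloop, add_zero]
    exact (Finset.sum_filter _ _).symm
  · by_cases hd : G.IsEssential d
    · rw [essentialPart, if_pos hd]
    · rw [essentialPart, if_neg hd, max_self]
      exact le_max_right _ _

end Essential

end TorusGraph

/-! ### Torus graphs as minors of a periodic grid -/

namespace TorusGraph

open SquareGrid

variable {V D : Type*}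

/-- A realization of a torus graph, up to its contractible loops, as a minor of the square grid
with period `N`: the vertices become disjoint connected sets of grid points, and the edges become
grid edges between these sets. The values of `edge` at inessential edges are irrelevant. -/
structure GridModel (G : TorusGraph V D) where
  /-- the period of the grid -/
  N : ℕ
  N_pos : 0 < N
  /-- the grid points contracted to a vertex -/
  blob : V → Finset (ℤ × ℤ)
  tree : ∀ v, GridTree (blob v)
  disjoint : ∀ {v w x a}, x ∈ blob v → x + N • a ∈ blob w → v = w ∧ a = 0
  /-- the grid edge that realizes an edge of the graph -/
  edge : D → Edge
  edge_mem : ∀ {d}, G.IsEssential d → (edge d).1 ∈ blob (G.src d)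
  edge_rev : ∀ {d}, G.IsEssential d → edge (G.rev d) + (N • G.shift d, 0) = reverse (edge d)
  edge_inj : ∀ {d e}, G.IsEssential d → G.IsEssential e → edge d = edge e → d = e

namespace GridModel

variable {G : TorusGraph V D} (M : GridModel G)

instance : NeZero M.N := ⟨M.N_pos.ne'⟩

open Classical in
/-- The translate `M.blob v + M.N • a` that contains a grid point, as the pair `(v, a)`. -/
noncomputable def owner (x : ℤ × ℤ) : Option (V × ℤ × ℤ) :=
  if h : ∃ p : V × ℤ × ℤ, x - M.N • p.2 ∈ M.blob p.1 then some h.choose else none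

variable {M}

lemma owner_eq_some {x : ℤ × ℤ} {p : V × ℤ × ℤ} :
    M.owner x = some p ↔ x - M.N • p.2 ∈ M.blob p.1 := by
  have hunique {p p' : V × ℤ × ℤ} (h : x - M.N • p.2 ∈ M.blob p.1)
      (h' : x - M.N • p'.2 ∈ M.blob p'.1) : p = p' := by
    have heq := M.disjoint (a := p.2 - p'.2) h (by rwa [smul_sub, sub_add_sub_cancel])
    exact Prod.ext heq.1 (sub_eq_zero.1 heq.2)
  unfold owner
  split_ifs with h
  · rw [Option.some_inj]
    exact ⟨fun hp => hp ▸ h.choose_spec, hunique h.choose_spec⟩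
  · exact iff_of_false (by simp) fun hp => h ⟨p, hp⟩

lemma owner_eq_some_zero {x : ℤ × ℤ} {v : V} : M.owner x = some (v, 0) ↔ x ∈ M.blob v := by
  rw [owner_eq_some, smul_zero, sub_zero]

lemma owner_add (x b : ℤ × ℤ) :
    M.owner (x + M.N • b) = (M.owner x).map fun p => (p.1, p.2 + b) := by
  ext p
  have h : x - M.N • (p.2 - b) = x + M.N • b - M.N • p.2 := by rw [smul_sub]; abel
  rw [owner_eq_some, ← h, ← owner_eq_some (p := (p.1, p.2 - b)), Option.map_eq_some_iff]
  refine ⟨fun hp => ⟨_, hp, by simp⟩, ?_⟩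
  rintro ⟨p, hp, rfl⟩
  simpa using hp

lemma owner_edge {d : D} (hd : G.IsEssential d) : M.owner (M.edge d).1 = some (G.src d, 0) :=
  owner_eq_some_zero.2 (M.edge_mem hd)

lemma owner_head_edge {d : D} (hd : G.IsEssential d) :
    M.owner (head (M.edge d)) = some (G.tgt d, G.shift d) := by
  have h : (M.edge (G.rev d)).1 + M.N • G.shift d = head (M.edge d) :=
    congrArg Prod.fst (M.edge_rev hd)
  rw [← h, owner_add, owner_edge (isEssential_rev.2 hd)]
  simp [tgt]

lemma edge_mem_boundary {d : D} (hd : G.IsEssential d) :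
    M.edge d ∈ boundary (M.blob (G.src d)) := by
  refine mem_boundary.2 ⟨M.edge_mem hd, fun h => ?_⟩
  rw [← owner_eq_some_zero, owner_head_edge hd, Option.some_inj, Prod.mk.injEq] at h
  exact hd.elim (fun h' => h' h.1.symm) fun h' => h' h.2

variable (M)

/-- The grid edges that are translates of the realization of an edge of the graph. -/
def IsModelEdge (e : Edge) : Prop := ∃ d a, G.IsEssential d ∧ M.edge d + (M.N • a, 0) = e

/-- The grid edges with both end points in the same translate of a blob. -/
def IsBlobEdge (e : Edge) : Prop := ∃ p, M.owner e.1 = some p ∧ M.owner (head e) = some p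

variable {M}

lemma sum_boundary_blob [Fintype D] [DecidableEq V] [DecidablePred G.IsEssential] {g : Edge → ℝ}
    (hg : ∀ e, g e ≠ 0 → M.IsBlobEdge e ∨ M.IsModelEdge e) (v : V) :
    ∑ e ∈ boundary (M.blob v), g e =
      ∑ d with G.src d = v, if G.IsEssential d then g (M.edge d) else 0 := by
  rw [← Finset.sum_filter, Finset.filter_filter]
  refine (Finset.sum_of_injOn M.edge (fun d hd e he => ?_) (fun d hd => ?_) (fun e he hed => ?_)
    fun d _ => rfl).symm
  · exact M.edge_inj (Finset.mem_filter.1 hd).2.2 (Finset.mem_filter.1 he).2.2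
  · obtain ⟨-, rfl, hess⟩ := Finset.mem_filter.1 (Finset.mem_coe.1 hd)
    exact edge_mem_boundary hess
  · by_contra hne
    rw [mem_boundary, ← owner_eq_some_zero, ← owner_eq_some_zero] at he
    rcases hg e hne with ⟨p, hp, hp'⟩ | ⟨d, a, hd, rfl⟩
    · exact he.2 (by rw [hp', ← hp, he.1])
    · have h := he.1
      rw [Prod.fst_add, owner_add, owner_edge hd, Option.map_some, Option.some_inj, Prod.mk.injEq,
        zero_add] at h
      exact hed ⟨d, by simpa [hd] using h.1, by simp [h.2]⟩

lemma sum_box_edge [Fintype D] [DecidablePred G.IsEssential] {E : Type*} [AddCommGroup E]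
    {g : Edge → E} (hg : ∀ e, g e ≠ 0 → M.IsModelEdge e)
    (hgN : ∀ e a, g (e + (M.N • a, 0)) = g e) :
    ∑ x ∈ box M.N, ∑ q, g (x, q) = ∑ d with G.IsEssential d, g (M.edge d) := by
  rw [← Finset.sum_product']
  refine (Finset.sum_of_injOn (fun d => wrapEdge M.N (M.edge d))
    (fun d hd e he hde => ?_) (fun d _ => ?_) (fun e he hed => ?_) fun d _ => ?_).symm
  · replace hd := (Finset.mem_filter.1 hd).2
    replace he := (Finset.mem_filter.1 he).2
    obtain ⟨a, ha⟩ := exists_eq_add_of_wrapEdge_eq hde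
    have hmem := M.edge_mem he
    rw [ha] at hmem
    obtain ⟨-, rfl⟩ := M.disjoint (M.edge_mem hd) hmem
    rw [smul_zero, Prod.mk_zero_zero, add_zero] at ha
    exact M.edge_inj hd he ha.symm
  · simp [wrapEdge, wrap_mem_box]
  · by_contra hne
    obtain ⟨d, a, hd, rfl⟩ := hg e hne
    rw [Finset.mem_product] at he
    refine hed ⟨d, by simpa using hd, ?_⟩
    beta_reduce
    rw [← wrapEdge_add (M.edge d) a, wrapEdge, wrap_of_mem_box he.1]
  · obtain ⟨a, ha⟩ := exists_wrapEdge_eq (N := M.N) (M.edge d)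
    exact (congrArg g ha).trans (hgN _ a) |>.symm

section Height

variable {h : ℤ × ℤ → ℝ} {ℓ : ℤ × ℤ →+ ℝ}

/-- The height functions of the periodic flows along the blobs and the realized edges. -/
structure IsHeight (M : GridModel G) (h : ℤ × ℤ → ℝ) (ℓ : ℤ × ℤ →+ ℝ) : Prop where
  quasiPeriodic : IsQuasiPeriodic M.N h ℓ
  carries : ∀ e, jump h e ≠ 0 → M.IsBlobEdge e ∨ M.IsModelEdge e

open Classical in
/-- The function on the edges of the graph given by a height function on the grid squares. -/
noncomputable def flowOf (M : GridModel G) (h : ℤ × ℤ → ℝ) (d : D) : ℝ :=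
  if G.IsEssential d then jump h (M.edge d) else 0

lemma flowOf_of_isEssential {d : D} (hd : G.IsEssential d) : M.flowOf h d = jump h (M.edge d) :=
  if_pos hd

lemma isEssential_of_flowOf_ne_zero {d : D} (hd : M.flowOf h d ≠ 0) : G.IsEssential d :=
  of_not_not fun hess => hd (if_neg hess)

lemma IsHeight.isFlow_flowOf [Fintype D] [DecidableEq V] (hh : M.IsHeight h ℓ) :
    G.IsFlow (M.flowOf h) := by
  classical
  refine ⟨fun d => ?_, fun v => ?_⟩
  · by_cases hd : G.IsEssential d
    · rw [flowOf_of_isEssential hd, flowOf_of_isEssential (isEssential_rev.2 hd),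
        ← isAntisymm_jump, ← M.edge_rev hd, hh.quasiPeriodic.jump_add]
    · rw [flowOf, flowOf, if_neg hd, if_neg (mt isEssential_rev.1 hd), neg_zero]
  · exact (sum_boundary_blob hh.carries v).symm.trans
      ((isAntisymm_jump h).sum_boundary fun x _ => sum_jump h x)

lemma IsHeight.boundaryFlux_blob [Fintype D] [DecidableEq V] (hh : M.IsHeight h ℓ) (v : V) :
    boundaryFlux (jump h) (M.blob v) / 2 = G.inflow (M.flowOf h) v := by
  classical
  rw [hh.isFlow_flowOf.inflow_eq, boundaryFlux,
    sum_boundary_blob fun e he => hh.carries e (abs_ne_zero.1 he)]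
  simp only [flowOf, apply_ite abs, abs_zero]

/-- The map on grid points that contracts every translate `M.blob v + M.N • a` to the point
`M.N • a`. -/
noncomputable def collapse (M : GridModel G) (x : ℤ × ℤ) : ℤ × ℤ :=
  (M.owner x).elim x fun p => M.N • p.2

lemma collapse_of_owner {x : ℤ × ℤ} {p : V × ℤ × ℤ} (h : M.owner x = some p) :
    M.collapse x = M.N • p.2 := by
  rw [collapse, h, Option.elim_some]

lemma collapse_add (x a : ℤ × ℤ) : M.collapse (x + M.N • a) = M.collapse x + M.N • a := by
  rw [collapse, owner_add, collapse]
  cases M.owner x with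
  | none => rfl
  | some p => exact smul_add ..

lemma collapse_head_of_isBlobEdge {e : Edge} (he : M.IsBlobEdge e) :
    M.collapse (head e) = M.collapse e.1 := by
  obtain ⟨p, htail, hhead⟩ := he
  rw [collapse_of_owner htail, collapse_of_owner hhead]

lemma collapse_head_edge {d : D} (hd : G.IsEssential d) :
    M.collapse (head (M.edge d)) - M.collapse (M.edge d).1 = M.N • G.shift d := by
  rw [collapse_of_owner (owner_head_edge hd), collapse_of_owner (owner_edge hd), smul_zero,
    sub_zero]

lemma IsHeight.sum_box_jump_smul_step (hh : M.IsHeight h ℓ) :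
    ∑ x ∈ box M.N, ∑ q, jump h (x, q) • latticeVec (step q)
      = (M.N : ℝ) • ((2 * ℓ (0, 1), -(2 * ℓ (1, 0))) : ℝ × ℝ) := by
  have hcorner (q : Fin 4) :
      corner q - corner (q + 3) = ![(0, 1), -(1, 0), -(0, 1), (1, 0)] q := by
    decide +revert
  rw [Finset.sum_comm]
  simp only [← Finset.sum_smul, hh.quasiPeriodic.sum_box_jump, mul_smul, ← Finset.smul_sum, hcorner]
  simp only [Fin.sum_univ_four, step, latticeVec, Matrix.cons_val, map_neg]
  congr 1
  ext <;> simp <;> ring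

lemma IsHeight.sum_flowOf_smul_shift [Fintype D] (hh : M.IsHeight h ℓ) :
    ∑ d, M.flowOf h d • latticeVec (G.shift d) = ((2 * ℓ (0, 1), -(2 * ℓ (1, 0))) : ℝ × ℝ) := by
  classical
  let g (e : Edge) : ℝ × ℝ := jump h e • latticeVec (M.collapse (head e) - M.collapse e.1)
  have hg (e : Edge) (he : g e ≠ 0) : M.IsModelEdge e :=
    (hh.carries e (left_ne_zero_of_smul he)).resolve_left fun hblob => he (by
      simp only [g, collapse_head_of_isBlobEdge hblob, sub_self, latticeVec_eq_zero.2, smul_zero])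
  have hgN (e : Edge) (a : ℤ × ℤ) : g (e + (M.N • a, 0)) = g e := by
    simp only [g, hh.quasiPeriodic.jump_add, head_add, Prod.fst_add, collapse_add,
      add_sub_add_right_eq_sub]
  have hmodel : ∑ x ∈ box M.N, ∑ q, g (x, q)
      = (M.N : ℝ) • ∑ d, M.flowOf h d • latticeVec (G.shift d) := by
    rw [sum_box_edge hg hgN, Finset.sum_filter, Finset.smul_sum]
    refine Finset.sum_congr rfl fun d _ => ?_
    by_cases hd : G.IsEssential d
    · rw [if_pos hd, flowOf_of_isEssential hd, smul_comm]
      simp only [g, collapse_head_edge hd]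
      simp [latticeVec]
    · simp [flowOf, hd]
  have hgrid : ∑ x ∈ box M.N, ∑ q, g (x, q)
      = ∑ x ∈ box M.N, ∑ q, jump h (x, q) • latticeVec (step q) := by
    have hψ := sum_box_smul_head_sub (isAntisymm_jump h) (sum_jump h) hh.quasiPeriodic.jump_add
      (ψ := fun x => latticeVec (M.collapse x - x)) fun x a => by
        rw [collapse_add, add_sub_add_right_eq_sub]
    rw [← sub_eq_zero, ← hψ]
    simp only [← Finset.sum_sub_distrib, ← smul_sub, ← latticeVec_sub, g, head]
    congr! 4
    abel
  exact smul_right_injective _ (NeZero.ne (M.N : ℝ))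
    (hmodel.symm.trans (hgrid.trans hh.sum_box_jump_smul_step))

lemma IsHeight.homologyClass_flowOf [Fintype D] (hh : M.IsHeight h ℓ) :
    G.homologyClass (M.flowOf h) = (ℓ (0, 1), -ℓ (1, 0)) := by
  classical
  rw [hh.isFlow_flowOf.homologyClass_eq, hh.sum_flowOf_smul_shift]
  simp

end Height

lemma IsBlobEdge.not_isModelEdge {e : Edge} (he : M.IsBlobEdge e) : ¬M.IsModelEdge e := by
  rintro ⟨d, a, hd, rfl⟩
  obtain ⟨p, htail, hhead⟩ := he
  rw [Prod.fst_add, owner_add, owner_edge hd, ← hhead, head_add, owner_add, owner_head_edge hd,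
    Option.map_some, Option.map_some, Option.some_inj, Prod.mk.injEq, add_left_inj] at htail
  exact not_isEssential.2 (htail.imp_right Eq.symm) hd

lemma isModelEdge_edge {d : D} (hd : G.IsEssential d) : M.IsModelEdge (M.edge d) :=
  ⟨d, 0, hd, by simp⟩

section BlobFlow

variable {F : V → Edge → ℝ}

/-- The periodic function on the grid edges that extends functions `F v` inside the blobs. -/
noncomputable def blobFlow (M : GridModel G) (F : V → Edge → ℝ) (e : Edge) : ℝ :=
  (M.owner e.1).elim 0 fun p => F p.1 (e + (M.N • -p.2, 0))

lemma blobFlow_of_owner {e : Edge} {p : V × ℤ × ℤ} (he : M.owner e.1 = some p) :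
    M.blobFlow F e = F p.1 (e + (M.N • -p.2, 0)) := by
  rw [blobFlow, he, Option.elim_some]

lemma blobFlow_of_mem_blob {e : Edge} {v : V} (he : e.1 ∈ M.blob v) : M.blobFlow F e = F v e := by
  rw [blobFlow_of_owner (owner_eq_some_zero.2 he), neg_zero, smul_zero, Prod.mk_zero_zero, add_zero]

lemma blobFlow_add (e : Edge) (a : ℤ × ℤ) :
    M.blobFlow F (e + (M.N • a, 0)) = M.blobFlow F e := by
  rcases he : M.owner e.1 with - | p
  · rw [blobFlow, blobFlow, Prod.fst_add, owner_add, he]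
    rfl
  · have he' : M.owner (e + (M.N • a, 0)).1 = some (p.1, p.2 + a) := by
      rw [Prod.fst_add, owner_add, he, Option.map_some]
    rw [blobFlow_of_owner he, blobFlow_of_owner he']
    congr 1
    ext <;> simp

lemma isBlobEdge_of_blobFlow_ne_zero
    (hF : ∀ v e, F v e ≠ 0 → e.1 ∈ M.blob v ∧ head e ∈ M.blob v) {e : Edge}
    (he : M.blobFlow F e ≠ 0) : M.IsBlobEdge e := by
  rcases hp : M.owner e.1 with - | p
  · exact absurd (by rw [blobFlow, hp, Option.elim_none]) he
  · rw [blobFlow_of_owner hp] at he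
    have hhead := (hF _ _ he).2
    rw [head_add, smul_neg, ← sub_eq_add_neg, ← owner_eq_some] at hhead
    exact ⟨p, hp, hhead⟩

lemma isAntisymm_blobFlow (hanti : ∀ v, IsAntisymm (F v))
    (hF : ∀ v e, F v e ≠ 0 → e.1 ∈ M.blob v ∧ head e ∈ M.blob v) :
    IsAntisymm (M.blobFlow F) := fun e => by
  by_cases he : M.IsBlobEdge e
  · obtain ⟨p, htail, hhead⟩ := he
    rw [blobFlow_of_owner htail, blobFlow_of_owner (e := reverse e) hhead, ← reverse_add, hanti]
  · have hzero : M.blobFlow F e = 0 := by_contra fun h => he (isBlobEdge_of_blobFlow_ne_zero hF h)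
    have hzero' : M.blobFlow F (reverse e) = 0 := by_contra fun h => by
      obtain ⟨p, htail, hhead⟩ := isBlobEdge_of_blobFlow_ne_zero hF h
      exact he ⟨p, by rwa [head_reverse] at hhead, htail⟩
    rw [hzero, hzero', neg_zero]

end BlobFlow

section ModelFlow

variable [Fintype D] {ω : D → ℝ}

open Classical in
/-- The periodic function on the grid edges that carries a function `ω` on the edges of the
graph. -/
noncomputable def modelFlow (M : GridModel G) (ω : D → ℝ) (e : Edge) : ℝ :=
  ∑ d, if G.IsEssential d ∧ wrapEdge M.N (M.edge d) = wrapEdge M.N e then ω d else 0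

lemma modelFlow_add (e : Edge) (a : ℤ × ℤ) :
    M.modelFlow ω (e + (M.N • a, 0)) = M.modelFlow ω e := by
  rw [modelFlow, wrapEdge_add, modelFlow]

lemma isModelEdge_of_modelFlow_ne_zero {e : Edge} (he : M.modelFlow ω e ≠ 0) :
    M.IsModelEdge e := by
  classical
  obtain ⟨d, -, hd⟩ := Finset.exists_ne_zero_of_sum_ne_zero he
  obtain ⟨hess, hwrap⟩ := (ite_ne_right_iff.1 hd).1
  obtain ⟨a, ha⟩ := exists_eq_add_of_wrapEdge_eq hwrap
  exact ⟨d, a, hess, ha.symm⟩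

lemma isAntisymm_modelFlow (hω : ∀ d, ω (G.rev d) = -ω d) : IsAntisymm (M.modelFlow ω) :=
    fun e => by
  classical
  have hreverse {e e' : Edge} (h : wrapEdge M.N e = wrapEdge M.N e') :
      wrapEdge M.N (reverse e) = wrapEdge M.N (reverse e') := by
    obtain ⟨a, rfl⟩ := exists_eq_add_of_wrapEdge_eq h
    rw [reverse_add, wrapEdge_add]
  have hiff (d : D) : G.IsEssential (G.rev d) ∧
      wrapEdge M.N (M.edge (G.rev d)) = wrapEdge M.N (reverse e) ↔
      G.IsEssential d ∧ wrapEdge M.N (M.edge d) = wrapEdge M.N e := by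
    rw [isEssential_rev]
    refine and_congr_right fun hd => ?_
    rw [← wrapEdge_add (M.edge (G.rev d)) (G.shift d), M.edge_rev hd]
    exact ⟨fun h => by simpa only [reverse_reverse] using hreverse h, hreverse⟩
  rw [modelFlow, modelFlow, ← G.sum_comp_rev, ← Finset.sum_neg_distrib]
  refine Finset.sum_congr rfl fun d _ => ?_
  rw [if_congr (hiff d) (hω d) neg_zero.symm, apply_ite Neg.neg]

open Classical in
lemma modelFlow_of_mem_blob {e : Edge} {v : V} (he : e.1 ∈ M.blob v) :
    M.modelFlow ω e = ∑ d, if G.IsEssential d ∧ M.edge d = e then ω d else 0 := by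
  refine Finset.sum_congr rfl fun d _ => if_congr (and_congr_right fun hd => ?_) rfl rfl
  refine ⟨fun hwrap => ?_, congrArg _⟩
  obtain ⟨a, rfl⟩ := exists_eq_add_of_wrapEdge_eq hwrap
  obtain ⟨-, rfl⟩ := M.disjoint (M.edge_mem hd) he
  simp

lemma modelFlow_edge {d : D} (hd : G.IsEssential d) : M.modelFlow ω (M.edge d) = ω d := by
  classical
  rw [modelFlow_of_mem_blob (M.edge_mem hd), Finset.sum_eq_single_of_mem d (Finset.mem_univ d)
    fun e _ hne => if_neg fun h => hne (M.edge_inj h.1 hd h.2), if_pos ⟨hd, rfl⟩]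

open Classical in
/-- The flow into a grid point along the realized edges. -/
noncomputable def demand (M : GridModel G) (ω : D → ℝ) (x : ℤ × ℤ) : ℝ :=
  -∑ d, if G.IsEssential d ∧ (M.edge d).1 = x then ω d else 0

lemma sum_modelFlow {x : ℤ × ℤ} {v : V} (hx : x ∈ M.blob v) :
    ∑ q, M.modelFlow ω (x, q) = -M.demand ω x := by
  classical
  rw [demand, neg_neg, Finset.sum_congr rfl fun q _ => modelFlow_of_mem_blob (e := (x, q)) hx,
    Finset.sum_comm]
  refine Finset.sum_congr rfl fun d _ => ?_
  simp [Prod.ext_iff, ← and_assoc, ite_and _ ((M.edge d).2 = _)]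

lemma sum_demand [DecidableEq V] (hω : G.IsFlow ω) (hess : ∀ d, ω d ≠ 0 → G.IsEssential d) (v : V) :
    ∑ x ∈ M.blob v, M.demand ω x = 0 := by
  classical
  simp only [demand, Finset.sum_neg_distrib]
  rw [neg_eq_zero, Finset.sum_comm]
  refine Eq.trans (Finset.sum_congr rfl fun d _ => ?_)
    ((Finset.sum_filter (G.src · = v) ω).symm.trans (hω.2 v))
  by_cases hd : G.IsEssential d
  · have hmem : (M.edge d).1 ∈ M.blob v ↔ G.src d = v := by
      rw [← owner_eq_some_zero, owner_edge hd]
      simp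
    simp [hd, hmem]
  · simp [hd, not_imp_comm.1 (hess d) hd]

end ModelFlow

lemma sum_blobFlow_add_modelFlow [Fintype D] {F : V → Edge → ℝ} {ω : D → ℝ}
    (hF : ∀ v, ∀ x ∈ M.blob v, ∑ q, F v (x, q) = M.demand ω x) (x : ℤ × ℤ) :
    ∑ q, (M.blobFlow F + M.modelFlow ω) (x, q) = 0 := by
  rcases hx : M.owner x with - | ⟨v, a⟩
  · refine Finset.sum_eq_zero fun q _ => ?_
    have hmodel : M.modelFlow ω (x, q) = 0 := by_contra fun h => by
      obtain ⟨d, b, hd, he⟩ := isModelEdge_of_modelFlow_ne_zero h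
      obtain rfl : (M.edge d).1 + M.N • b = x := congrArg Prod.fst he
      rw [owner_add, owner_edge hd] at hx
      exact Option.some_ne_none _ hx
    rw [Pi.add_apply, hmodel, blobFlow, hx, Option.elim_none, add_zero]
  · obtain ⟨y, rfl⟩ : ∃ y, y + M.N • a = x := ⟨x - M.N • a, sub_add_cancel _ _⟩
    have hy : y ∈ M.blob v := by simpa using owner_eq_some.1 hx
    have htranslate (q : Fin 4) : ((y + M.N • a, q) : Edge) = (y, q) + (M.N • a, 0) :=
      Prod.ext rfl (add_zero q).symm
    simp only [htranslate, Pi.add_apply, blobFlow_add, modelFlow_add, Finset.sum_add_distrib]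
    rw [sum_modelFlow hy, ← hF v y hy, ← sub_eq_add_neg, sub_eq_zero]
    exact Finset.sum_congr rfl fun q _ => blobFlow_of_mem_blob (e := (y, q)) hy

lemma exists_isHeight [Fintype D] [DecidableEq V] (M : GridModel G) {ω : D → ℝ} (hω : G.IsFlow ω)
    (hess : ∀ d, ω d ≠ 0 → G.IsEssential d) :
    ∃ h ℓ, M.IsHeight h ℓ ∧ M.flowOf h = ω ∧ ∀ v, RangeBound h (M.blob v) := by
  choose F hF hFdemand using fun v => (M.tree v).exists_treeFlow (M.demand ω) (sum_demand hω hess v)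
  have hblob (v : V) (e : Edge) : F v e ≠ 0 → e.1 ∈ M.blob v ∧ head e ∈ M.blob v :=
    (hF v).mem_of_ne_zero
  have hanti : IsAntisymm (M.blobFlow F + M.modelFlow ω) := fun e => by
    rw [Pi.add_apply, Pi.add_apply, isAntisymm_blobFlow (fun v => (hF v).isAntisymm) hblob,
      isAntisymm_modelFlow hω.1, neg_add]
  obtain ⟨h, hh⟩ := exists_jump_eq hanti (sum_blobFlow_add_modelFlow hFdemand)
  have hjump (e : Edge) : jump h e = M.blobFlow F e + M.modelFlow ω e := congrFun hh e
  obtain ⟨ℓ, hℓ⟩ := exists_isQuasiPeriodic (N := M.N) (h := h) fun e a => by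
    rw [hjump, hjump, blobFlow_add, modelFlow_add]
  refine ⟨h, ℓ, ⟨hℓ, fun e he => ?_⟩, funext fun d => ?_, fun v => ?_⟩
  · rw [hjump] at he
    by_cases hmodel : M.modelFlow ω e = 0
    · exact .inl (isBlobEdge_of_blobFlow_ne_zero hblob (by rwa [hmodel, add_zero] at he))
    · exact .inr (isModelEdge_of_modelFlow_ne_zero hmodel)
  · by_cases hd : G.IsEssential d
    · have hzero : M.blobFlow F (M.edge d) = 0 := by_contra fun hne =>
        (isBlobEdge_of_blobFlow_ne_zero hblob hne).not_isModelEdge (isModelEdge_edge hd)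
      rw [flowOf_of_isEssential hd, hjump, hzero, zero_add, modelFlow_edge hd]
    · rw [flowOf, if_neg hd, not_imp_comm.1 (hess d) hd]
  · refine (hF v).rangeBound fun e htail hhead => ?_
    have hzero : M.modelFlow ω e = 0 := by_contra fun hne =>
      IsBlobEdge.not_isModelEdge ⟨_, owner_eq_some_zero.2 htail, owner_eq_some_zero.2 hhead⟩
        (isModelEdge_of_modelFlow_ne_zero hne)
    rw [hjump, hzero, add_zero, blobFlow_of_mem_blob htail]

end GridModel

end TorusGraph

/-! ### Rounding -/

open Set in
lemma exists_intCast_mem_uIoc_of_floor_ne {x y : ℝ} (h : ⌊x⌋ ≠ ⌊y⌋) :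
    ∃ n : ℤ, (n : ℝ) ∈ uIoc x y := by
  rcases lt_or_gt_of_ne h with h | h
  · exact ⟨⌊y⌋, mem_uIoc.2 (.inl ⟨Int.floor_lt.1 h, Int.floor_le y⟩)⟩
  · exact ⟨⌊x⌋, mem_uIoc.2 (.inr ⟨Int.floor_lt.1 h, Int.floor_le x⟩)⟩

lemma abs_floor_sub_floor_le_one {x y : ℝ} (h : |x - y| ≤ 1) : |⌊x⌋ - ⌊y⌋| ≤ 1 := by
  obtain ⟨hyx, hxy⟩ := abs_sub_le_iff.1 h
  refine abs_sub_le_iff.2 ⟨?_, ?_⟩ <;>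
    rw [sub_le_iff_le_add', ← Int.floor_add_one] <;> exact Int.floor_le_floor (by linarith)

/-- The intersection number of two homology classes of the torus. -/
def intersectionHom (c : ℤ × ℤ) : ℤ × ℤ →+ ℤ :=
  AddMonoidHom.mk' (fun a => c.1 * a.2 - c.2 * a.1) fun a b => by
    simp only [Prod.fst_add, Prod.snd_add]
    ring

lemma intersectionHom_apply (c a : ℤ × ℤ) : intersectionHom c a = c.1 * a.2 - c.2 * a.1 := rfl

lemma addMonoidHom_eq_mul_intersectionHom {ℓ : ℤ × ℤ →+ ℝ} {k : ℕ} {c : ℤ × ℤ}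
    (h : ((ℓ (0, 1), -ℓ (1, 0)) : ℝ × ℝ) = latticeVec (k • c)) (a : ℤ × ℤ) :
    ℓ a = k * intersectionHom c a := by
  obtain ⟨h1, h2⟩ : ℓ (0, 1) = k * c.1 ∧ -ℓ (1, 0) = k * c.2 := by
    simpa [latticeVec, Prod.ext_iff] using h
  have ha : a = a.1 • (1, 0) + a.2 • (0, 1) := by simp
  rw [ha, map_add, map_zsmul, map_zsmul, h1, neg_eq_iff_eq_neg.1 h2, ← ha, intersectionHom_apply,
    zsmul_eq_mul, zsmul_eq_mul]
  push_cast
  ring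

namespace TorusGraph

open SquareGrid

variable {V D : Type*}

/-- A decomposition of a flow of class `k • c` into `k` flows of class `c` with values `0, ±1` and
vertex-disjoint supports. By `level_sub`, the class of every cycle in these supports has
intersection number `0` with `c`. -/
structure Rounding [Fintype D] [DecidableEq V] (G : TorusGraph V D) (ω : D → ℝ) (k : ℕ)
    (c : ℤ × ℤ) where
  /-- the flows of class `c` -/
  flow : Fin k → D → ℝ
  /-- a potential for the intersection numbers with `k • c` of the edges in the supports -/
  level : V → ℤ
  isFlow : ∀ m, G.IsFlow (flow m)
  flow_cases : ∀ m d, flow m d = 0 ∨ flow m d = 1 ∨ flow m d = -1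
  support : ∀ {m d}, flow m d ≠ 0 → ω d ≠ 0
  homologyClass_flow : ∀ m, G.homologyClass (flow m) = latticeVec c
  disjoint : ∀ {m m' d d'}, flow m d ≠ 0 → flow m' d' ≠ 0 → G.src d = G.src d' → m = m'
  level_sub : ∀ {m d}, flow m d ≠ 0 →
    level (G.src d) - level (G.tgt d) = k * intersectionHom c (G.shift d)

namespace GridModel

variable {G : TorusGraph V D} {M : GridModel G} {h : ℤ × ℤ → ℝ} {ℓ : ℤ × ℤ →+ ℝ} {k : ℕ}

/-- The heights around the blob of `v` lie on both sides of the level `t`. -/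
def Straddles (M : GridModel G) (h : ℤ × ℤ → ℝ) (v : V) (t : ℤ) : Prop :=
  ∃ d e : Edge, d.1 ∈ M.blob v ∧ e.1 ∈ M.blob v ∧ (t : ℝ) ∈ Set.uIoc (h (left d)) (h (left e))

lemma Straddles.unique {v : V} {t u : ℤ}
    (hosc : ∀ d e : Edge, d.1 ∈ M.blob v → e.1 ∈ M.blob v → |h (left d) - h (left e)| ≤ 1)
    (ht : M.Straddles h v t) (hu : M.Straddles h v u) : t = u := by
  have hle {t u : ℤ} (ht : M.Straddles h v t) (hu : M.Straddles h v u) : t ≤ u := by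
    obtain ⟨d, e, hd, he, ht⟩ := ht
    obtain ⟨d', e', hd', he', hu⟩ := hu
    have hdd := le_of_abs_le (hosc d d' hd hd')
    have hde := le_of_abs_le (hosc d e' hd he')
    have hed := le_of_abs_le (hosc e d' he hd')
    have hee := le_of_abs_le (hosc e e' he he')
    have hlt : (t : ℝ) < u + 1 := by
      rcases Set.mem_uIoc.1 ht with ht | ht <;> rcases Set.mem_uIoc.1 hu with hu | hu <;>
        linarith [ht.2, hu.1]
    exact Int.lt_add_one_iff.1 (by exact_mod_cast hlt)
  exact le_antisymm (hle ht hu) (hle hu ht)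

lemma exists_level
    (hosc : ∀ v, ∀ d e : Edge, d.1 ∈ M.blob v → e.1 ∈ M.blob v → |h (left d) - h (left e)| ≤ 1) :
    ∃ T : V → ℤ, ∀ v t, M.Straddles h v t → T v = t := by
  have hlevel (v : V) : ∃ T, ∀ t, M.Straddles h v t → T = t := by
    by_cases hv : ∃ t, M.Straddles h v t
    · exact ⟨_, fun t ht => hv.choose_spec.unique (hosc v) ht⟩
    · exact ⟨0, fun t ht => absurd ⟨t, ht⟩ hv⟩
  exact Classical.axiomOfChoice hlevel

/-- The height function obtained by counting the levels in `m + k • ℤ` below `h`. -/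
noncomputable def roundedHeight (h : ℤ × ℤ → ℝ) {k : ℕ} (m : Fin k) (s : ℤ × ℤ) : ℝ :=
  ⌊(h s - (m : ℕ)) / k⌋

lemma jump_ne_zero_of_jump_roundedHeight_ne_zero {m : Fin k} {e : Edge}
    (he : jump (roundedHeight h m) e ≠ 0) : jump h e ≠ 0 := fun hzero => he (by
  rw [jump, roundedHeight, sub_eq_zero.1 hzero, roundedHeight, sub_self])

lemma IsHeight.roundedHeight (hh : M.IsHeight h ℓ) {lam : ℤ × ℤ →+ ℤ}
    (hℓ : ∀ a, ℓ a = k * lam a) (m : Fin k) :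
    M.IsHeight (roundedHeight h m) ((Int.castAddHom ℝ).comp lam) where
  quasiPeriodic s a := by
    have hk : (k : ℝ) ≠ 0 := Nat.cast_ne_zero.2 m.pos.ne'
    have hshift : (h (s + M.N • a) - (m : ℕ)) / k = (h s - (m : ℕ)) / k + lam a := by
      rw [hh.quasiPeriodic, hℓ]
      field_simp
      ring
    rw [GridModel.roundedHeight, hshift, Int.floor_add_intCast, Int.cast_add]
    rfl
  carries e he := hh.carries e (jump_ne_zero_of_jump_roundedHeight_ne_zero he)

lemma flowOf_roundedHeight_ne_zero {m : Fin k} {d : D} (hd : M.flowOf (roundedHeight h m) d ≠ 0) :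
    M.flowOf h d ≠ 0 := by
  have hess := isEssential_of_flowOf_ne_zero hd
  rw [flowOf_of_isEssential hess] at hd ⊢
  exact jump_ne_zero_of_jump_roundedHeight_ne_zero hd

lemma flowOf_roundedHeight_cases
    (hosc : ∀ v, ∀ d e : Edge, d.1 ∈ M.blob v → e.1 ∈ M.blob v → |h (left d) - h (left e)| ≤ 1)
    (m : Fin k) (d : D) :
    M.flowOf (roundedHeight h m) d = 0 ∨ M.flowOf (roundedHeight h m) d = 1 ∨
      M.flowOf (roundedHeight h m) d = -1 := by
  by_cases hd : G.IsEssential d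
  · have hjump : |h (left (M.edge d)) - h (right (M.edge d))| ≤ 1 :=
      hosc _ _ ((M.edge d).1, (M.edge d).2 + 3) (M.edge_mem hd) (M.edge_mem hd)
    have hfloor := abs_floor_sub_floor_le_one (x := (h (left (M.edge d)) - (m : ℕ)) / k)
      (y := (h (right (M.edge d)) - (m : ℕ)) / k) (by
        rw [← sub_div, sub_sub_sub_cancel_right, abs_div, Nat.abs_cast]
        exact div_le_one_of_le₀ (hjump.trans (Nat.one_le_cast.2 m.pos)) k.cast_nonneg)
    rw [flowOf_of_isEssential hd, jump, roundedHeight, roundedHeight]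
    have hcases := abs_le.1 hfloor
    norm_cast
    omega
  · exact .inl (if_neg hd)

lemma exists_mem_uIoc_of_flowOf_roundedHeight_ne_zero {m : Fin k} {d : D}
    (hd : M.flowOf (roundedHeight h m) d ≠ 0) :
    ∃ n : ℤ, ((m + k * n : ℤ) : ℝ) ∈ Set.uIoc (h (left (M.edge d))) (h (right (M.edge d))) := by
  have hess := isEssential_of_flowOf_ne_zero hd
  rw [flowOf_of_isEssential hess, jump, sub_ne_zero] at hd
  obtain ⟨n, hn⟩ := exists_intCast_mem_uIoc_of_floor_ne (fun h => hd (congrArg Int.cast h))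
  have hk : (0 : ℝ) < k := Nat.cast_pos.2 m.pos
  refine ⟨n, ?_⟩
  simp only [Set.mem_uIoc, div_lt_iff₀ hk, le_div_iff₀ hk] at hn ⊢
  push_cast
  exact hn.imp (fun hn => ⟨by linarith [hn.1], by linarith [hn.2]⟩)
    fun hn => ⟨by linarith [hn.1], by linarith [hn.2]⟩

lemma exists_straddles_of_flowOf_roundedHeight_ne_zero (hh : M.IsHeight h ℓ) {lam : ℤ × ℤ →+ ℤ}
    (hℓ : ∀ a, ℓ a = k * lam a) {m : Fin k} {d : D} (hd : M.flowOf (roundedHeight h m) d ≠ 0) :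
    ∃ n : ℤ, M.Straddles h (G.src d) (m + k * n) ∧
      M.Straddles h (G.tgt d) (m + k * n - k * lam (G.shift d)) := by
  have hess := isEssential_of_flowOf_ne_zero hd
  have hess' := M.edge_mem (isEssential_rev.2 hess)
  obtain ⟨n, hn⟩ := exists_mem_uIoc_of_flowOf_roundedHeight_ne_zero hd
  have hleft : h (right (M.edge d)) = h (left (M.edge (G.rev d))) + k * lam (G.shift d) := by
    rw [← left_reverse, ← M.edge_rev hess, left_add, hh.quasiPeriodic, hℓ]
  have hright : h (left (M.edge d)) = h (right (M.edge (G.rev d))) + k * lam (G.shift d) := by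
    rw [← right_reverse, ← M.edge_rev hess, right_add, hh.quasiPeriodic, hℓ]
  refine ⟨n, ⟨M.edge d, ((M.edge d).1, (M.edge d).2 + 3), M.edge_mem hess, M.edge_mem hess, hn⟩,
    ((M.edge (G.rev d)).1, (M.edge (G.rev d)).2 + 3), M.edge (G.rev d), hess', hess', ?_⟩
  rw [hleft, hright] at hn
  simp only [Set.mem_uIoc] at hn ⊢
  push_cast at hn ⊢
  exact hn.imp (fun hn => ⟨lt_sub_iff_add_lt.2 hn.1, sub_le_iff_le_add.2 hn.2⟩)
    fun hn => ⟨lt_sub_iff_add_lt.2 hn.1, sub_le_iff_le_add.2 hn.2⟩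

lemma nonempty_rounding [Fintype D] [DecidableEq V] (M : GridModel G) {ω : D → ℝ}
    (hω : ω ∈ G.unitFlows) (hess : ∀ d, ω d ≠ 0 → G.IsEssential d) {c : ℤ × ℤ}
    (hc : G.homologyClass ω = latticeVec (k • c)) : Nonempty (G.Rounding ω k c) := by
  obtain ⟨h, ℓ, hh, rfl, hrange⟩ := M.exists_isHeight hω.1 hess
  rw [hh.homologyClass_flowOf] at hc
  have hℓ := addMonoidHom_eq_mul_intersectionHom hc
  have hosc (v : V) (d e : Edge) (hd : d.1 ∈ M.blob v) (he : e.1 ∈ M.blob v) :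
      |h (left d) - h (left e)| ≤ 1 :=
    (hrange v d e hd he).trans ((hh.boundaryFlux_blob v).trans_le (hω.2 v))
  obtain ⟨T, hT⟩ := exists_level hosc
  refine ⟨⟨fun m => M.flowOf (roundedHeight h m), T, ?_, flowOf_roundedHeight_cases hosc,
    flowOf_roundedHeight_ne_zero, ?_, ?_, ?_⟩⟩
  · exact fun m => (hh.roundedHeight hℓ m).isFlow_flowOf
  · intro m
    rw [(hh.roundedHeight hℓ m).homologyClass_flowOf]
    simp [latticeVec, intersectionHom_apply]
  · intro m m' d d' hd hd' hsrc
    obtain ⟨n, hn, -⟩ := exists_straddles_of_flowOf_roundedHeight_ne_zero hh hℓ hd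
    obtain ⟨n', hn', -⟩ := exists_straddles_of_flowOf_roundedHeight_ne_zero hh hℓ hd'
    rw [← hsrc] at hn'
    have hmod := congrArg (· % (k : ℤ)) (hn.unique (hosc _) hn')
    simp only [Int.add_mul_emod_self_left] at hmod
    norm_cast at hmod
    rwa [Nat.mod_eq_of_lt m.2, Nat.mod_eq_of_lt m'.2, Fin.val_inj] at hmod
  · intro m d hd
    obtain ⟨n, hn, hn'⟩ := exists_straddles_of_flowOf_roundedHeight_ne_zero hh hℓ hd
    rw [hT _ _ hn, hT _ _ hn', sub_sub_cancel]

end GridModel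

end TorusGraph

/-! ### Directed loops -/

namespace TorusGraph

variable {V D : Type*}

/-- A loop of a torus graph that traverses no edge in both directions. It is encoded as a periodic
orbit of a map on oriented edges. -/
structure DirectedLoop (G : TorusGraph V D) where
  next : D → D
  start : D
  start_mem_periodicPts : start ∈ Function.periodicPts next
  src_next {d : D} : d ∈ Function.periodicOrbit next start → G.src (next d) = G.tgt d
  src_injOn : Set.InjOn G.src {d | d ∈ Function.periodicOrbit next start}
  rev_notMem {d : D} : d ∈ Function.periodicOrbit next start →
    G.rev d ∉ Function.periodicOrbit next start

namespace DirectedLoop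

variable {G : TorusGraph V D} (L : G.DirectedLoop) {d e : D}

/-- The cyclic sequence of edges of a loop. -/
noncomputable def cycle : Cycle D := Function.periodicOrbit L.next L.start

lemma mem_cycle : d ∈ L.cycle ↔ ∃ n, L.next^[n] L.start = d :=
  Function.mem_periodicOrbit_iff L.start_mem_periodicPts

lemma rev_notMem_cycle (hd : d ∈ L.cycle) : G.rev d ∉ L.cycle := L.rev_notMem hd

lemma start_mem : L.start ∈ L.cycle := L.mem_cycle.2 ⟨0, rfl⟩

lemma next_mem (hd : d ∈ L.cycle) : L.next d ∈ L.cycle := by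
  obtain ⟨n, rfl⟩ := L.mem_cycle.1 hd
  exact L.mem_cycle.2 ⟨n + 1, Function.iterate_succ_apply' _ _ _⟩

lemma exists_next_eq (he : e ∈ L.cycle) : ∃ d ∈ L.cycle, L.next d = e := by
  obtain ⟨n, rfl⟩ := L.mem_cycle.1 he
  obtain ⟨m, hm, hper⟩ := L.start_mem_periodicPts
  refine ⟨L.next^[n + m - 1] L.start, L.mem_cycle.2 ⟨_, rfl⟩, ?_⟩
  rw [← Function.iterate_succ_apply' L.next, show (n + m - 1).succ = n + m by omega,
    Function.iterate_add_apply, hper.eq]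

lemma next_injOn : Set.InjOn L.next {d | d ∈ L.cycle} := by
  refine (Function.bijOn_periodicPts L.next).injOn.mono fun d hd => ?_
  obtain ⟨n, rfl⟩ := L.mem_cycle.1 hd
  obtain ⟨m, hm, hper⟩ := L.start_mem_periodicPts
  exact ⟨m, hm, hper.apply_iterate n⟩

lemma next_eq_of_src_eq (hd : d ∈ L.cycle) (he : e ∈ L.cycle) (h : G.src e = G.tgt d) :
    e = L.next d :=
  L.src_injOn he (L.next_mem hd) (h.trans (L.src_next hd).symm)

lemma tgt_injOn : Set.InjOn G.tgt {d | d ∈ L.cycle} := fun _ hd _ he h =>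
  L.next_injOn hd he (L.next_eq_of_src_eq he (L.next_mem hd) ((L.src_next hd).trans h))

lemma isLoop : G.IsLoop L.cycle := by
  refine ⟨?_, ?_, ?_⟩
  · exact fun h => Function.periodicOrbit_eq_nil_iff_not_periodic_pt.1 h L.start_mem_periodicPts
  · refine (Function.periodicOrbit_chain' _ L.start_mem_periodicPts).2 fun n => ?_
    rw [Function.iterate_succ_apply']
    exact (L.src_next (L.mem_cycle.2 ⟨n, rfl⟩)).symm
  · have hnodup : L.cycle.Nodup := Function.nodup_periodicOrbit
    have hinj : Set.InjOn G.src {d | d ∈ L.cycle} := L.src_injOn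
    induction h : L.cycle using Quotient.inductionOn' with
    | h l =>
      rw [h] at hnodup hinj
      exact List.Nodup.map_on (fun x hx y hy hxy => hinj hx hy hxy) hnodup

open Classical in
/-- The unit flow along a loop. -/
noncomputable def flow (d : D) : ℝ :=
  (if d ∈ L.cycle then 1 else 0) - if G.rev d ∈ L.cycle then 1 else 0

lemma flow_of_mem (hd : d ∈ L.cycle) : L.flow d = 1 := by
  rw [flow, if_pos hd, if_neg (L.rev_notMem_cycle hd), sub_zero]

lemma flow_rev (d : D) : L.flow (G.rev d) = -L.flow d := by
  rw [flow, flow, G.rev_rev, neg_sub]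

lemma flow_of_rev_mem (hd : G.rev d ∈ L.cycle) : L.flow d = -1 := by
  rw [← neg_eq_iff_eq_neg, ← flow_rev, L.flow_of_mem hd]

lemma flow_of_notMem (hd : d ∉ L.cycle) (hd' : G.rev d ∉ L.cycle) : L.flow d = 0 := by
  rw [flow, if_neg hd, if_neg hd', sub_zero]

lemma mem_or_rev_mem_of_flow_ne_zero (hd : L.flow d ≠ 0) : d ∈ L.cycle ∨ G.rev d ∈ L.cycle := by
  by_contra! h
  exact hd (L.flow_of_notMem h.1 h.2)

lemma flow_cases (d : D) : L.flow d = 0 ∨ L.flow d = 1 ∨ L.flow d = -1 := by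
  rcases em (L.flow d = 0) with h | h
  · exact .inl h
  · exact .inr ((L.mem_or_rev_mem_of_flow_ne_zero h).imp L.flow_of_mem L.flow_of_rev_mem)

lemma flow_eq_one_iff : L.flow d = 1 ↔ d ∈ L.cycle := by
  refine ⟨fun h => ?_, L.flow_of_mem⟩
  refine (L.mem_or_rev_mem_of_flow_ne_zero (h ▸ one_ne_zero)).resolve_right fun hd => ?_
  norm_num [L.flow_of_rev_mem hd] at h

open Classical in
lemma max_flow_zero (d : D) : max (L.flow d) 0 = if d ∈ L.cycle then 1 else 0 := by
  simp only [← L.flow_eq_one_iff]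
  rcases L.flow_cases d with h | h | h <;> norm_num [h]

lemma exists_src_eq_of_flow_ne_zero (hd : L.flow d ≠ 0) : ∃ e ∈ L.cycle, G.src e = G.src d := by
  rcases L.mem_or_rev_mem_of_flow_ne_zero hd with h | h
  · exact ⟨d, h, rfl⟩
  · exact ⟨_, L.next_mem h, by rw [L.src_next h, tgt_rev]⟩

lemma apply_ne_zero_of_flow_ne_zero {ω : D → ℝ} (hω : ∀ d, ω (G.rev d) = -ω d)
    (hL : ∀ d ∈ L.cycle, ω d = 1) (hd : L.flow d ≠ 0) : ω d ≠ 0 := by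
  rcases L.mem_or_rev_mem_of_flow_ne_zero hd with h | h
  · simp [hL d h]
  · rw [← neg_ne_zero, ← hω, hL _ h]
    exact one_ne_zero

open Classical in
lemma sum_flow_smul [Fintype D] {M : Type*} [AddCommGroup M] [Module ℝ M] {φ : D → M}
    (hφ : ∀ d, φ (G.rev d) = -φ d) :
    ∑ d, L.flow d • φ d = (2 : ℝ) • ∑ d with d ∈ L.cycle, φ d := by
  have hrev : ∑ d, (if G.rev d ∈ L.cycle then (1 : ℝ) else 0) • φ d
      = -∑ d, (if d ∈ L.cycle then (1 : ℝ) else 0) • φ d := by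
    rw [← G.sum_comp_rev, ← Finset.sum_neg_distrib]
    simp only [G.rev_rev, hφ, smul_neg]
  simp only [flow, sub_smul, Finset.sum_sub_distrib]
  rw [hrev, sub_neg_eq_add, ← two_smul ℝ]
  simp only [ite_smul, one_smul, zero_smul, Finset.sum_filter]

variable [Fintype D] [DecidableEq V]

lemma isFlow_flow : G.IsFlow L.flow := by
  classical
  refine ⟨L.flow_rev, fun v => ?_⟩
  have hin : ∑ d with G.src d = v, (if G.rev d ∈ L.cycle then (1 : ℝ) else 0)
      = ∑ d with G.tgt d = v, if d ∈ L.cycle then (1 : ℝ) else 0 := by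
    rw [Finset.sum_filter, Finset.sum_filter, ← G.sum_comp_rev]
    simp only [G.rev_rev]
    rfl
  simp only [flow, Finset.sum_sub_distrib]
  rw [hin, sub_eq_zero, ← Finset.sum_filter, ← Finset.sum_filter]
  simp only [Finset.filter_filter]
  refine (Finset.sum_nbij L.next (fun d hd => ?_) (fun d hd e he => ?_) (fun e he => ?_)
    fun _ _ => rfl).symm
  · rw [Finset.mem_filter_univ] at hd ⊢
    exact ⟨(L.src_next hd.2).trans hd.1, L.next_mem hd.2⟩
  · rw [Finset.mem_coe, Finset.mem_filter_univ] at hd he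
    exact L.next_injOn hd.2 he.2
  · rw [Finset.mem_coe, Finset.mem_filter_univ] at he
    obtain ⟨d, hd, rfl⟩ := L.exists_next_eq he.2
    exact ⟨d, by simpa using ⟨(L.src_next hd).symm.trans he.1, hd⟩, rfl⟩

lemma flow_mem_unitFlows : L.flow ∈ G.unitFlows := by
  classical
  refine ⟨L.isFlow_flow, fun v => ?_⟩
  simp only [inflow, max_flow_zero]
  rw [← Finset.sum_filter, Finset.sum_const, nsmul_one, Nat.cast_le_one, Finset.card_le_one]
  intro d hd e he
  simp only [Finset.mem_filter, Finset.mem_univ, true_and] at hd he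
  exact L.tgt_injOn hd.2 he.2 (hd.1.trans he.1.symm)

section Supported

variable {η : D → ℝ}

lemma apply_next_of_support (hη : G.IsFlow η) (hs : ∀ d, η d ≠ 0 → L.flow d ≠ 0)
    (hd : d ∈ L.cycle) : η (L.next d) = η d := by
  have hsum := hη.2 (G.tgt d)
  rw [Finset.sum_eq_add_of_mem (L.next d) (G.rev d) (by simpa using L.src_next hd)
    (by rw [Finset.mem_filter_univ]; rfl)
    (fun h => L.rev_notMem hd (h ▸ L.next_mem hd)), hη.1] at hsum
  · linarith
  rintro e he ⟨hnext, hrev⟩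
  replace he : G.src e = G.tgt d := by simpa using he
  by_contra h0
  rcases L.mem_or_rev_mem_of_flow_ne_zero (hs e h0) with hmem | hmem
  · exact hnext (L.next_eq_of_src_eq hd hmem he)
  · exact hrev (by rw [← L.tgt_injOn hmem hd (by rw [tgt_rev, he]), G.rev_rev])

lemma eq_smul_flow_of_support (hη : G.IsFlow η) (hs : ∀ d, η d ≠ 0 → L.flow d ≠ 0) :
    η = η L.start • L.flow := by
  have hcycle : ∀ d ∈ L.cycle, η d = η L.start := by
    intro d hd
    obtain ⟨n, rfl⟩ := L.mem_cycle.1 hd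
    clear hd
    induction n with
    | zero => rfl
    | succ n ih =>
      rw [Function.iterate_succ_apply', L.apply_next_of_support hη hs (L.mem_cycle.2 ⟨n, rfl⟩), ih]
  funext d
  rw [Pi.smul_apply, smul_eq_mul]
  by_cases h0 : L.flow d = 0
  · rw [h0, mul_zero, of_not_not fun h => hs d h h0]
  rcases L.mem_or_rev_mem_of_flow_ne_zero h0 with hd | hd
  · rw [hcycle d hd, L.flow_of_mem hd, mul_one]
  · rw [L.flow_of_rev_mem hd, mul_neg_one, ← hcycle _ hd, hη.1, neg_neg]

end Supported

end DirectedLoop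

variable {G : TorusGraph V D}

lemma exists_directedLoop [Finite D] {P : Set D} (hne : P.Nonempty)
    (hrev : ∀ d ∈ P, G.rev d ∉ P) (hP : ∀ d ∈ P, ∃ e ∈ P, G.src e = G.tgt d) :
    ∃ L : G.DirectedLoop, ∀ d ∈ L.cycle, d ∈ P := by
  obtain ⟨d₀, hd₀⟩ := hne
  have : Nonempty D := ⟨d₀⟩
  choose! out hout hsrc using fun (v : V) (hv : v ∈ G.src '' P) => hv
  let next d := out (G.tgt d)
  have hmaps : Set.MapsTo next P P := fun d hd => hout _ (hP d hd)
  have hmaps' : Set.MapsTo next (next '' P) (next '' P) :=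
    Set.mapsTo_image_iff.2 fun d hd => ⟨next d, hmaps hd, rfl⟩
  obtain ⟨m, n, hmn, heq⟩ : ∃ m n, m < n ∧ next^[m] (next d₀) = next^[n] (next d₀) := by
    obtain ⟨m, n, hmn, heq⟩ := Finite.exists_ne_map_eq_of_infinite fun n : ℕ => next^[n] (next d₀)
    rcases hmn.lt_or_gt with h | h
    exacts [⟨m, n, h, heq⟩, ⟨n, m, h, heq.symm⟩]
  let start := next^[m] (next d₀)
  have hper : start ∈ Function.periodicPts next := by
    refine ⟨n - m, by omega, ?_⟩
    rw [Function.IsPeriodicPt, Function.IsFixedPt, ← Function.iterate_add_apply,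
      Nat.sub_add_cancel hmn.le, ← heq]
  have hmem : ∀ d ∈ Function.periodicOrbit next start, d ∈ P ∧ out (G.src d) = d := by
    intro d hd
    obtain ⟨i, rfl⟩ := (Function.mem_periodicOrbit_iff hper).1 hd
    obtain ⟨e, he, heq⟩ := hmaps'.iterate i (hmaps'.iterate m ⟨d₀, hd₀, rfl⟩)
    rw [← heq]
    exact ⟨hmaps he, congrArg out (hsrc _ (hP e he))⟩
  exact ⟨⟨next, start, hper, fun {d} hd => hsrc _ (hP d (hmem d hd).1),
    fun d hd e he h => by rw [← (hmem d hd).2, h, (hmem e he).2],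
    fun hd hd' => hrev _ (hmem _ hd).1 (hmem _ hd').1⟩, fun d hd => (hmem d hd).1⟩

section TernaryFlow

variable [Fintype D] [DecidableEq V] {ω : D → ℝ}

lemma IsFlow.exists_src_eq_tgt (hω : G.IsFlow ω) (hcases : ∀ d, ω d = 0 ∨ ω d = 1 ∨ ω d = -1)
    {d : D} (hd : ω d = 1) : ∃ e, ω e = 1 ∧ G.src e = G.tgt d := by
  by_contra! h
  refine (hω.2 (G.tgt d)).not_lt (Finset.sum_neg' (fun e he => ?_) ⟨G.rev d, ?_, ?_⟩)
  · rcases hcases e with h0 | h1 | h1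
    · exact h0.le
    · exact absurd (by simpa using he) (h e h1)
    · exact h1.trans_le (by norm_num)
  · exact Finset.mem_filter.2 ⟨Finset.mem_univ _, rfl⟩
  · norm_num [hω.1, hd]

lemma IsFlow.exists_directedLoop (hω : G.IsFlow ω)
    (hcases : ∀ d, ω d = 0 ∨ ω d = 1 ∨ ω d = -1) {d : D} (hd : ω d ≠ 0) :
    ∃ L : G.DirectedLoop, ∀ d ∈ L.cycle, ω d = 1 := by
  refine TorusGraph.exists_directedLoop (P := {d | ω d = 1}) ?_ (fun e he he' => ?_)
    fun e he => hω.exists_src_eq_tgt hcases he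
  · rcases hcases d with h | h | h
    exacts [absurd h hd, ⟨d, h⟩, ⟨G.rev d, by simp [hω.1, h]⟩]
  · rw [Set.mem_ofPred_eq] at he he'
    norm_num [hω.1, he] at he'

end TernaryFlow

lemma IsFlow.sub [Fintype D] [DecidableEq V] {ω η : D → ℝ} (hω : G.IsFlow ω) (hη : G.IsFlow η) :
    G.IsFlow (ω - η) :=
  ⟨fun d => by simp only [Pi.sub_apply, hω.1, hη.1]; ring,
    fun v => by simp only [Pi.sub_apply, Finset.sum_sub_distrib, hω.2, hη.2, sub_zero]⟩

open Classical in
lemma DirectedLoop.sub_flow_apply (L : G.DirectedLoop) {ω : D → ℝ}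
    (hω : ∀ d, ω (G.rev d) = -ω d) (hL : ∀ d ∈ L.cycle, ω d = 1) (d : D) :
    (ω - L.flow) d = if d ∈ L.cycle ∨ G.rev d ∈ L.cycle then 0 else ω d := by
  rw [Pi.sub_apply]
  split_ifs with h
  · rcases h with h | h
    · rw [hL d h, L.flow_of_mem h, sub_self]
    · rw [L.flow_of_rev_mem h, ← neg_eq_iff_eq_neg.1 ((hω d).symm.trans (hL _ h)), sub_self]
  · rw [L.flow_of_notMem (not_or.1 h).1 (not_or.1 h).2, sub_zero]

lemma IsFlow.exists_directedLoop_pos [Fintype D] [DecidableEq V] (φ : (D → ℝ) →ₗ[ℝ] ℝ)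
    {ω : D → ℝ} (hω : G.IsFlow ω) (hcases : ∀ d, ω d = 0 ∨ ω d = 1 ∨ ω d = -1)
    (hpos : 0 < φ ω) :
    ∃ L : G.DirectedLoop, (∀ d ∈ L.cycle, ω d = 1) ∧ 0 < φ L.flow := by
  classical
  induction hn : Finset.card {d | ω d = 1} using Nat.strong_induction_on generalizing ω with
  | _ n ih =>
    obtain ⟨d, hd⟩ := Function.ne_iff.1 fun h : ω = 0 => hpos.ne' (by rw [h, map_zero])
    obtain ⟨L, hL⟩ := hω.exists_directedLoop hcases hd
    by_cases hLpos : 0 < φ L.flow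
    · exact ⟨L, hL, hLpos⟩
    have happly := L.sub_flow_apply hω.1 hL
    have hone : ∀ d, (ω - L.flow) d = 1 → ω d = 1 ∧ d ∉ L.cycle := by
      intro d hd
      rw [happly] at hd
      split_ifs at hd with h
      · norm_num at hd
      · exact ⟨hd, fun hmem => h (.inl hmem)⟩
    have hlt : Finset.card {d | (ω - L.flow) d = 1} < n := by
      rw [← hn]
      refine Finset.card_lt_card (Finset.ssubset_iff_of_subset ?_ |>.2 ⟨L.start, ?_, ?_⟩)
      · exact Finset.monotone_filter_right _ fun d _ hd => (hone d hd).1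
      · simpa using hL _ L.start_mem
      · simpa using fun h => (hone _ h).2 L.start_mem
    obtain ⟨L', hL', hpos'⟩ := ih _ hlt (hω.sub L.isFlow_flow)
      (fun d => by rw [happly]; split_ifs; exacts [.inl rfl, hcases d])
      (by rw [map_sub]; linarith) rfl
    exact ⟨L', fun d hd => (hone d (hL' d hd)).1, hpos'⟩

section VertexDisjointFamily

variable {ι : Type*} [Fintype ι] {L : ι → G.DirectedLoop}

lemma IsFlow.sum [Fintype D] [DecidableEq V] {ω : ι → D → ℝ} (hω : ∀ m, G.IsFlow (ω m)) :
    G.IsFlow (∑ m, ω m) := by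
  refine ⟨fun d => ?_, fun v => ?_⟩
  · simp only [Finset.sum_apply, (hω _).1, Finset.sum_neg_distrib]
  · simp only [Finset.sum_apply]
    rw [Finset.sum_comm]
    exact Finset.sum_eq_zero fun m _ => (hω m).2 v

lemma sum_flow_apply
    (hL : Pairwise fun m m' => G.VertexDisjoint (L m).cycle (L m').cycle)
    {m : ι} {d e : D} (he : e ∈ (L m).cycle) (hsrc : G.src e = G.src d) :
    (∑ m', (L m').flow) d = (L m).flow d := by
  rw [Finset.sum_apply]
  refine Finset.sum_eq_single_of_mem m (Finset.mem_univ m) fun m' _ hne => ?_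
  by_contra hd
  obtain ⟨e', he', hsrc'⟩ := (L m').exists_src_eq_of_flow_ne_zero hd
  exact hL hne e' he' e he (hsrc'.trans hsrc.symm)

lemma exists_sum_flow_apply_eq
    (hL : Pairwise fun m m' => G.VertexDisjoint (L m).cycle (L m').cycle)
    {d : D} (hd : (∑ m, (L m).flow) d ≠ 0) :
    ∃ m, (∑ m', (L m').flow) d = (L m).flow d := by
  rw [Finset.sum_apply] at hd
  obtain ⟨m, -, hm⟩ := Finset.exists_ne_zero_of_sum_ne_zero hd
  obtain ⟨e, he, hsrc⟩ := (L m).exists_src_eq_of_flow_ne_zero hm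
  exact ⟨m, sum_flow_apply hL he hsrc⟩

lemma sum_flow_cases
    (hL : Pairwise fun m m' => G.VertexDisjoint (L m).cycle (L m').cycle) (d : D) :
    (∑ m, (L m).flow) d = 0 ∨ (∑ m, (L m).flow) d = 1 ∨ (∑ m, (L m).flow) d = -1 := by
  by_cases hd : (∑ m, (L m).flow) d = 0
  · exact .inl hd
  · obtain ⟨m, hm⟩ := exists_sum_flow_apply_eq hL hd
    exact hm ▸ (L m).flow_cases d

lemma sum_flow_eq_one_iff
    (hL : Pairwise fun m m' => G.VertexDisjoint (L m).cycle (L m').cycle) {d : D} :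
    (∑ m, (L m).flow) d = 1 ↔ ∃ m, d ∈ (L m).cycle := by
  refine ⟨fun hd => ?_, fun ⟨m, hm⟩ => ?_⟩
  · obtain ⟨m, hm⟩ := exists_sum_flow_apply_eq hL (hd ▸ one_ne_zero)
    exact ⟨m, (L m).flow_eq_one_iff.1 (hm ▸ hd)⟩
  · rw [sum_flow_apply hL hm rfl, (L m).flow_of_mem hm]

lemma sum_flow_mem_unitFlows [Fintype D] [DecidableEq V]
    (hL : Pairwise fun m m' => G.VertexDisjoint (L m).cycle (L m').cycle) :
    ∑ m, (L m).flow ∈ G.unitFlows := by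
  have hflow : G.IsFlow (∑ m, (L m).flow) := IsFlow.sum fun m => (L m).isFlow_flow
  refine ⟨hflow, fun v => ?_⟩
  by_cases hv : ∃ m, ∃ e ∈ (L m).cycle, G.src e = v
  · obtain ⟨m, e, he, rfl⟩ := hv
    refine (le_of_eq ?_).trans ((L m).flow_mem_unitFlows.2 (G.src e))
    rw [hflow.inflow_eq, (L m).isFlow_flow.inflow_eq]
    refine congrArg (· / 2) (Finset.sum_congr rfl fun d hd => ?_)
    rw [sum_flow_apply hL he (Finset.mem_filter.1 hd).2.symm]
  · push Not at hv
    rw [hflow.inflow_eq, Finset.sum_eq_zero fun d hd => ?_]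
    · norm_num
    rw [abs_eq_zero, Finset.sum_apply]
    refine Finset.sum_eq_zero fun m _ => ?_
    by_contra hm
    obtain ⟨e, he, hsrc⟩ := (L m).exists_src_eq_of_flow_ne_zero hm
    exact hv m e he (hsrc.trans (Finset.mem_filter.1 hd).2)

end VertexDisjointFamily

end TorusGraph

lemma exists_eq_zsmul_of_intersectionHom_eq_zero {c a : ℤ × ℤ} (hc : IsCoprime c.1 c.2)
    (h : intersectionHom c a = 0) : ∃ n : ℤ, a = n • c := by
  obtain ⟨u, w, huw⟩ := hc
  rw [intersectionHom_apply] at h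
  refine ⟨u * a.1 + w * a.2, Prod.ext ?_ ?_⟩
  · rw [Prod.smul_fst, smul_eq_mul]
    linear_combination (-a.1) * huw - w * h
  · rw [Prod.smul_snd, smul_eq_mul]
    linear_combination (-a.2) * huw + u * h

namespace TorusGraph

variable {V D : Type*} [Fintype D] {G : TorusGraph V D} {ω : D → ℝ} {k : ℕ}
  {c : ℤ × ℤ}

namespace DirectedLoop

variable (L : G.DirectedLoop)

open Classical in
lemma homologyClass_flow :
    G.homologyClass L.flow = latticeVec (∑ d with d ∈ L.cycle, G.shift d) := by
  classical
  rw [L.isFlow_flow.homologyClass_eq, L.sum_flow_smul fun d => by rw [shift_rev, latticeVec_neg],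
    smul_smul, one_div_mul_cancel two_ne_zero, one_smul]
  exact (map_sum (AddMonoidHom.mk' latticeVec latticeVec_add) _ _).symm

/-- On the support of a rounding the level is a potential for the intersection number with `c`. -/
lemma exists_homologyClass_flow_eq_zsmul [DecidableEq V] (hc : IsCoprime c.1 c.2)
    (R : G.Rounding ω k c) {m : Fin k}
    (hL : ∀ d ∈ L.cycle, R.flow m d = 1) :
    ∃ n : ℤ, G.homologyClass L.flow = (n : ℝ) • latticeVec c := by
  classical
  have hzero : (2 * k : ℝ) * intersectionHom c (∑ d with d ∈ L.cycle, G.shift d) = 0 := by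
    have hlevel : ∀ d, L.flow d • (k * intersectionHom c (G.shift d) : ℝ)
        = -L.flow d • ((R.level (G.tgt d) : ℝ) - R.level (G.src d)) := by
      intro d
      by_cases hd : L.flow d = 0
      · simp [hd]
      · have := R.level_sub (L.apply_ne_zero_of_flow_ne_zero (R.isFlow m).1 hL hd)
        rw [neg_smul, ← smul_neg, neg_sub]
        exact_mod_cast congrArg (L.flow d • ·) (congrArg (Int.cast (R := ℝ)) this.symm)
    have hsum := L.sum_flow_smul (φ := fun d => (k * intersectionHom c (G.shift d) : ℝ))
      fun d => by simp [shift_rev]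
    rw [Finset.sum_congr rfl fun d _ => hlevel d] at hsum
    simp only [neg_smul, Finset.sum_neg_distrib] at hsum
    rw [L.isFlow_flow.sum_smul_sub fun v => (R.level v : ℝ), neg_zero, ← Finset.mul_sum] at hsum
    rw [map_sum, mul_assoc, Int.cast_sum]
    exact hsum.symm
  have hk : (2 * k : ℝ) ≠ 0 := mul_ne_zero two_ne_zero (Nat.cast_ne_zero.2 m.pos.ne')
  obtain ⟨n, hn⟩ := exists_eq_zsmul_of_intersectionHom_eq_zero hc
    (Int.cast_eq_zero.1 ((mul_eq_zero.1 hzero).resolve_left hk))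
  exact ⟨n, by rw [homologyClass_flow, hn, latticeVec_zsmul]⟩

/-- A flow supported on the loop is a multiple of `L.flow`, so the flows of a rounding of `L.flow`
have class `±k • c` or `0`. -/
lemma eq_one_of_homologyClass_flow_eq_nsmul (M : GridModel G)
    (hess : ∀ d, L.flow d ≠ 0 → G.IsEssential d) (hc : c ≠ 0) (hk : 0 < k)
    (hclass : G.homologyClass L.flow = latticeVec (k • c)) : k = 1 := by
  classical
  obtain ⟨R⟩ := M.nonempty_rounding L.flow_mem_unitFlows hess hclass
  let m : Fin k := ⟨0, hk⟩
  have hsmul := L.eq_smul_flow_of_support (R.isFlow m) fun _ => R.support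
  have hclass' := R.homologyClass_flow m
  rw [hsmul, G.isLinearMap_homologyClass.map_smul, hclass, ← natCast_zsmul, latticeVec_zsmul,
    smul_smul] at hclass'
  replace hclass' := smul_left_injective ℝ (latticeVec_eq_zero.not.2 hc)
    (hclass'.trans (one_smul ℝ _).symm)
  have hk' : (1 : ℝ) ≤ k := Nat.one_le_cast.2 hk
  rcases R.flow_cases m L.start with h | h | h <;> rw [h] at hclass'
  · norm_num at hclass'
  · simpa using hclass'
  · simp at hclass'
    linarith

end DirectedLoop

lemma Rounding.exists_primitive_loop [DecidableEq V] (M : GridModel G) (R : G.Rounding ω k c)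
    (hess : ∀ d, ω d ≠ 0 → G.IsEssential d) (hc : IsCoprime c.1 c.2) (m : Fin k) :
    ∃ L : G.DirectedLoop, (∀ d ∈ L.cycle, R.flow m d = 1) ∧
      G.homologyClass L.flow = latticeVec c := by
  obtain ⟨u, w, huw⟩ := hc
  let φ : ℝ × ℝ →ₗ[ℝ] ℝ := (u : ℝ) • LinearMap.fst ℝ ℝ ℝ + (w : ℝ) • LinearMap.snd ℝ ℝ ℝ
  have hφ : φ (latticeVec c) = 1 := by simpa [φ, latticeVec] using mod_cast huw
  obtain ⟨L, hL, hpos⟩ := (R.isFlow m).exists_directedLoop_pos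
    (φ ∘ₗ G.isLinearMap_homologyClass.mk' _) (R.flow_cases m)
    (by simp [R.homologyClass_flow, hφ])
  refine ⟨L, hL, ?_⟩
  obtain ⟨n, hn⟩ := L.exists_homologyClass_flow_eq_zsmul ⟨u, w, huw⟩ R hL
  rw [LinearMap.comp_apply, IsLinearMap.mk'_apply, hn, map_smul, hφ, smul_eq_mul, mul_one,
    Int.cast_pos] at hpos
  lift n to ℕ using hpos.le
  have hone := L.eq_one_of_homologyClass_flow_eq_nsmul M (fun d hd => hess d (R.support
    (L.apply_ne_zero_of_flow_ne_zero (R.isFlow m).1 hL hd))) (c := c) (k := n)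
    (by rintro rfl; simp at huw) (by exact_mod_cast hpos)
    (by rw [hn, ← natCast_zsmul, latticeVec_zsmul])
  rw [hn, hone, Nat.cast_one, Int.cast_one, one_smul]

end TorusGraph

/-! ### Construction of the grid model -/

namespace TorusGraph

open SquareGrid

variable {V D : Type*}

/-- A thickening of a torus graph on the square grid with period `N`: every vertex is replaced by
a connected set of grid points, its disk, and every edge by a set of grid points, its tube, that
joins the disks of its ends and avoids all other disks. Of every edge only one orientation is
used for the disjointness of tubes. -/
structure GridThickening (G : TorusGraph V D) where
  /-- the period of the grid -/
  N : ℕ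
  N_pos : 0 < N
  /-- a choice of one orientation of every edge -/
  orientation : Set D
  mem_orientation : ∀ {d}, d ∈ orientation ↔ G.rev d ∉ orientation
  /-- the grid points near a vertex -/
  disk : V → Set (ℤ × ℤ)
  finite_disk : ∀ v, (disk v).Finite
  /-- a grid point from which the disk is reached -/
  center : V → ℤ × ℤ
  center_mem : ∀ v, center v ∈ disk v
  reachable_center : ∀ {v x}, x ∈ disk v → Reachable (disk v) (center v) x
  disk_disjoint : ∀ {v w x a}, x ∈ disk v → x + N • a ∈ disk w → v = w ∧ a = 0
  disk_separated : ∀ {v w a} {e : Edge}, e.1 ∈ disk v → head e + N • a ∈ disk w → v = w ∧ a = 0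
  /-- the grid points near an edge -/
  tube : D → Set (ℤ × ℤ)
  finite_tube : ∀ d, (tube d).Finite
  tube_disk : ∀ {d w x a}, x ∈ tube d → x - N • a ∈ disk w →
    (w = G.src d ∧ a = 0) ∨ (w = G.tgt d ∧ a = G.shift d)
  tube_disjoint : ∀ {d e x a}, d ∈ orientation → e ∈ orientation → x ∈ tube d →
    x + N • a ∈ tube e → d = e ∧ a = 0
  exists_walk : ∀ d, ∃ x ∈ disk (G.src d), ∃ y, y - N • G.shift d ∈ disk (G.tgt d) ∧
    x ∈ tube d ∧ Reachable (tube d) x y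

namespace GridThickening

variable {G : TorusGraph V D} (T : GridThickening G) {v w : V} {d e : D} {x a : ℤ × ℤ}

/-- The disk around the end of an edge, in the translate in which the tube of the edge ends. -/
def targetDisk (d : D) : Set (ℤ × ℤ) := {x | x - T.N • G.shift d ∈ T.disk (G.tgt d)}

/-- A grid point where the tube of an edge meets the disk of the start of the edge. -/
noncomputable def walkStart (d : D) : ℤ × ℤ := (T.exists_walk d).choose

/-- The part of the tube of an edge that can be reached from its start without entering the disk
of its end. -/
def stem (d : D) : Set (ℤ × ℤ) := {x | Reachable (T.tube d \ T.targetDisk d) (T.walkStart d) x}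

/-- A grid edge that leads from the stem of an edge to the disk of its end. -/
noncomputable def exit (d : D) : Edge :=
  Classical.epsilon fun p => p.1 ∈ T.stem d ∧ head p ∈ T.targetDisk d

variable {T}

lemma walkStart_mem_disk : T.walkStart d ∈ T.disk (G.src d) := (T.exists_walk d).choose_spec.1

lemma walkStart_notMem (hd : G.IsEssential d) : T.walkStart d ∉ T.targetDisk d := fun h => by
  have := T.disk_disjoint (a := -G.shift d) walkStart_mem_disk
    (by rwa [smul_neg, ← sub_eq_add_neg])
  exact not_isEssential.2 (this.imp_right neg_eq_zero.1) hd

variable (T) in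
lemma exit_spec (hd : G.IsEssential d) :
    (T.exit d).1 ∈ T.stem d ∧ head (T.exit d) ∈ T.targetDisk d := by
  obtain ⟨-, y, hy, -, hwalk⟩ := (T.exists_walk d).choose_spec
  exact Classical.epsilon_spec (hwalk.exists_first_entry (walkStart_notMem hd) hy)

lemma stem_subset (hd : G.IsEssential d) : T.stem d ⊆ T.tube d \ T.targetDisk d := fun _ hx =>
  hx.mem ⟨(T.exists_walk d).choose_spec.2.choose_spec.2.1, walkStart_notMem hd⟩

lemma disk_disjoint_stem (he : G.IsEssential e) (hx : x ∈ T.disk v) (hxa : x + T.N • a ∈ T.stem e) :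
    v = G.src e ∧ a = 0 := by
  obtain ⟨htube, htarget⟩ := stem_subset he hxa
  refine (T.tube_disk (a := a) htube (by rwa [add_sub_cancel_right])).resolve_right ?_
  rintro ⟨rfl, rfl⟩
  exact htarget (by rwa [targetDisk, Set.mem_ofPred_eq, add_sub_cancel_right])

lemma exit_notMem_disk (hd : G.IsEssential d) : (T.exit d).1 ∉ T.disk v := fun h => by
  obtain ⟨hstem, hhead⟩ := T.exit_spec hd
  obtain ⟨rfl, -⟩ := disk_disjoint_stem (a := 0) hd h (by rwa [smul_zero, add_zero])
  have := T.disk_separated (a := -G.shift d) h (by rwa [smul_neg, ← sub_eq_add_neg])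
  exact not_isEssential.2 (this.imp_right neg_eq_zero.1) hd

variable (T) in
/-- The disk of a vertex together with the stems of the chosen essential edges that start there. -/
def blob (v : V) : Set (ℤ × ℤ) :=
  T.disk v ∪ ⋃ d ∈ {d ∈ T.orientation | G.IsEssential d ∧ G.src d = v}, T.stem d

lemma disk_subset_blob : T.disk v ⊆ T.blob v := Set.subset_union_left

lemma stem_subset_blob (hdT : d ∈ T.orientation) (hd : G.IsEssential d) :
    T.stem d ⊆ T.blob (G.src d) :=
  (Set.subset_biUnion_of_mem (u := T.stem) (show d ∈ {_d ∈ _ | _} from ⟨hdT, hd, rfl⟩)).trans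
    Set.subset_union_right

lemma mem_blob : x ∈ T.blob v ↔
    x ∈ T.disk v ∨ ∃ d ∈ T.orientation, G.IsEssential d ∧ G.src d = v ∧ x ∈ T.stem d := by
  simp only [blob, Set.mem_union, Set.mem_iUnion, Set.mem_ofPred_eq, exists_prop, and_assoc]

lemma finite_blob [Finite D] : (T.blob v).Finite :=
  (T.finite_disk v).union <| (Set.toFinite _).biUnion fun d hd =>
    (T.finite_tube d).subset ((stem_subset hd.2.1).trans Set.sdiff_subset)

lemma reachable_blob (hx : x ∈ T.blob v) : Reachable (T.blob v) (T.center v) x := by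
  rw [mem_blob] at hx
  obtain hx | ⟨d, hdT, hd, rfl, hx⟩ := hx
  · exact (T.reachable_center hx).mono disk_subset_blob
  · refine ((T.reachable_center walkStart_mem_disk).mono disk_subset_blob).trans ?_
    change Reachable _ _ _ at hx
    induction hx with
    | refl => exact .refl
    | @tail y z hxy hyz ih =>
      exact ih.tail ⟨stem_subset_blob hdT hd (hxy.tail hyz), hyz.2⟩

lemma blob_disjoint (hx : x ∈ T.blob v) (hxa : x + T.N • a ∈ T.blob w) : v = w ∧ a = 0 := by
  rw [mem_blob] at hx hxa
  obtain hx | ⟨d, hdT, hd, rfl, hx⟩ := hx <;> obtain hxa | ⟨e, heT, he, rfl, hxa⟩ := hxa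
  · exact T.disk_disjoint hx hxa
  · exact disk_disjoint_stem he hx hxa
  · obtain ⟨hw, ha⟩ := disk_disjoint_stem (a := -a) hd hxa (by rwa [smul_neg, add_neg_cancel_right])
    exact ⟨hw.symm, neg_eq_zero.1 ha⟩
  · obtain ⟨rfl, ha⟩ := T.tube_disjoint hdT heT (stem_subset hd hx).1 (stem_subset he hxa).1
    exact ⟨rfl, ha⟩

variable (T) in
open Classical in
/-- The grid edge for an edge `d`: the exit of its stem, or the reverse of the exit of the stem of
`G.rev d` if that is the chosen orientation. -/
noncomputable def edge (d : D) : Edge :=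
  if d ∈ T.orientation then T.exit d
  else reverse (T.exit (G.rev d)) + (T.N • G.shift d, 0)

lemma edge_of_mem (hd : d ∈ T.orientation) : T.edge d = T.exit d := if_pos hd

lemma edge_of_notMem (hd : d ∉ T.orientation) :
    T.edge d = reverse (T.exit (G.rev d)) + (T.N • G.shift d, 0) := if_neg hd

lemma rev_mem_orientation (hd : d ∉ T.orientation) : G.rev d ∈ T.orientation :=
  of_not_not (mt T.mem_orientation.2 hd)

lemma edge_mem_disk (hdT : d ∉ T.orientation) (hd : G.IsEssential d) :
    (T.edge d).1 ∈ T.disk (G.src d) := by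
  have h := (T.exit_spec (isEssential_rev.2 hd)).2
  rw [targetDisk, Set.mem_ofPred_eq, tgt_rev, shift_rev, smul_neg, sub_neg_eq_add] at h
  rwa [edge_of_notMem hdT]

lemma edge_mem_blob (hd : G.IsEssential d) : (T.edge d).1 ∈ T.blob (G.src d) := by
  by_cases hdT : d ∈ T.orientation
  · rw [edge_of_mem hdT]
    exact stem_subset_blob hdT hd (T.exit_spec hd).1
  · exact disk_subset_blob (edge_mem_disk hdT hd)

lemma edge_rev (d : D) : T.edge (G.rev d) + (T.N • G.shift d, 0) = reverse (T.edge d) := by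
  by_cases hdT : d ∈ T.orientation
  · rw [edge_of_mem hdT, edge_of_notMem (T.mem_orientation.1 hdT), G.rev_rev, shift_rev, add_assoc]
    simp
  · rw [edge_of_notMem hdT, edge_of_mem (rev_mem_orientation hdT), reverse_add, reverse_reverse]

lemma exit_inj (hdT : d ∈ T.orientation) (heT : e ∈ T.orientation) (hd : G.IsEssential d)
    (he : G.IsEssential e) (h : T.exit d + (T.N • a, 0) = T.exit e) : d = e := by
  have he' : _ ∈ T.tube e := (stem_subset he (T.exit_spec he).1).1
  rw [← h] at he'
  exact (T.tube_disjoint hdT heT (stem_subset hd (T.exit_spec hd).1).1 he').1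

lemma edge_inj (hd : G.IsEssential d) (he : G.IsEssential e) (h : T.edge d = T.edge e) : d = e := by
  by_cases hdT : d ∈ T.orientation <;> by_cases heT : e ∈ T.orientation
  · refine exit_inj (a := 0) hdT heT hd he ?_
    rw [← edge_of_mem hdT, ← edge_of_mem heT, h]
    simp
  · have := h ▸ edge_mem_disk heT he
    exact absurd (edge_of_mem hdT ▸ this) (exit_notMem_disk hd)
  · have := h ▸ edge_mem_disk hdT hd
    exact absurd (edge_of_mem heT ▸ this) (exit_notMem_disk he)
  · have hdT' := rev_mem_orientation hdT
    have heT' := rev_mem_orientation heT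
    have h' := congrArg reverse h
    rw [← edge_rev, ← edge_rev, edge_of_mem hdT', edge_of_mem heT'] at h'
    have := exit_inj (a := G.shift d - G.shift e) hdT' heT' (isEssential_rev.2 hd)
      (isEssential_rev.2 he) ?_
    · rw [← G.rev_rev d, this, G.rev_rev]
    · rw [← add_right_cancel_iff (a := (T.N • G.shift e, (0 : Fin 4))), ← h', add_assoc]
      simp [smul_sub]

variable (T) in
/-- The grid model with the blobs and the grid edges of a thickening. -/
noncomputable def gridModel [Finite D] : GridModel G where
  N := T.N
  N_pos := T.N_pos
  blob v := (finite_blob (T := T) (v := v)).toFinset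
  tree v := GridTree.of_reachable (x₀ := T.center v)
    (by simpa using disk_subset_blob (T.center_mem v)) (by simpa using fun _ _ => reachable_blob)
  disjoint hx hxa := by
    rw [Set.Finite.mem_toFinset] at hx hxa
    exact blob_disjoint hx hxa
  edge := T.edge
  edge_mem hd := by simpa using edge_mem_blob hd
  edge_rev _ := T.edge_rev _
  edge_inj := edge_inj

end GridThickening

end TorusGraph

lemma isClosedEmbedding_latticeVec : Topology.IsClosedEmbedding latticeVec :=
  Int.isClosedEmbedding_coe_real.prodMap Int.isClosedEmbedding_coe_real

namespace SquareGrid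

/-- The point of the plane at a grid point, for the grid of mesh `1 / N`. -/
noncomputable def gridPoint (N : ℕ) (x : ℤ × ℤ) : ℝ × ℝ := (N : ℝ)⁻¹ • latticeVec x

/-- The grid point to the lower left of a point of the plane, for the grid of mesh `1 / N`. -/
noncomputable def gridFloor (N : ℕ) (z : ℝ × ℝ) : ℤ × ℤ := (⌊N * z.1⌋, ⌊N * z.2⌋)

section Mesh

variable {N : ℕ}

lemma gridPoint_add_smul [NeZero N] (x a : ℤ × ℤ) :
    gridPoint N (x + N • a) = gridPoint N x + latticeVec a := by
  have hsmul : latticeVec (N • a) = (N : ℝ) • latticeVec a := by simp [latticeVec]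
  rw [gridPoint, latticeVec_add, hsmul, smul_add, inv_smul_smul₀ (NeZero.ne (N : ℝ)), gridPoint]

lemma dist_gridPoint_head_le (e : Edge) :
    dist (gridPoint N (head e)) (gridPoint N e.1) ≤ (N : ℝ)⁻¹ := by
  have hstep (q : Fin 4) : ‖latticeVec (step q)‖ = 1 := by
    fin_cases q <;> simp [latticeVec, step, Prod.norm_def]
  rw [gridPoint, gridPoint, dist_eq_norm, ← smul_sub, ← latticeVec_sub, head, add_sub_cancel_left,
    norm_smul, hstep, mul_one, norm_inv, Real.norm_natCast]

lemma dist_gridPoint_gridFloor_le [NeZero N] (z : ℝ × ℝ) :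
    dist (gridPoint N (gridFloor N z)) z ≤ (N : ℝ)⁻¹ := by
  have h (t : ℝ) : dist ((N : ℝ)⁻¹ * ⌊N * t⌋) t ≤ (N : ℝ)⁻¹ := by
    have hN : (0 : ℝ) < N := mod_cast NeZero.pos N
    have heq : (N : ℝ)⁻¹ * ⌊N * t⌋ - t = -((N : ℝ)⁻¹ * Int.fract (N * t)) := by
      rw [Int.fract]
      field_simp
      ring
    rw [Real.dist_eq, heq, abs_neg, abs_of_nonneg (by positivity)]
    exact mul_le_of_le_one_right (by positivity) (Int.fract_lt_one _).le
  exact max_le (h z.1) (h z.2)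

lemma finite_gridPoint_preimage [NeZero N] {K : Set (ℝ × ℝ)} (hK : Bornology.IsBounded K) :
    (gridPoint N ⁻¹' K).Finite := by
  have hemb : Topology.IsClosedEmbedding (gridPoint N) :=
    (Homeomorph.smulOfNeZero (N : ℝ)⁻¹ (by simp [NeZero.ne N])).isClosedEmbedding.comp
      isClosedEmbedding_latticeVec
  exact (hemb.isCompact_preimage hK.isCompact_closure).finite_of_discrete.subset
    (Set.preimage_mono subset_closure)

lemma reachable_gridPoint_ball {z : ℝ × ℝ} {r : ℝ} {x y : ℤ × ℤ}
    (hx : gridPoint N x ∈ Metric.ball z r) (hy : gridPoint N y ∈ Metric.ball z r) :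
    Reachable (gridPoint N ⁻¹' Metric.ball z r) x y := by
  have hconn (t : ℝ) : ((fun n : ℤ => (N : ℝ)⁻¹ * n) ⁻¹' Metric.ball t r).OrdConnected :=
    (convex_ball t r).ordConnected.preimage_mono fun m n hmn => by gcongr
  have hball : gridPoint N ⁻¹' Metric.ball z r =
      ((fun n : ℤ => (N : ℝ)⁻¹ * n) ⁻¹' Metric.ball z.1 r) ×ˢ
        ((fun n : ℤ => (N : ℝ)⁻¹ * n) ⁻¹' Metric.ball z.2 r) := by
    rw [← Prod.mk.eta (p := z), ← ball_prod_same]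
    rfl
  rw [← Set.mem_preimage, hball] at hx hy
  rw [hball]
  exact reachable_prod (hconn _) (hconn _) hx hy

lemma reachable_gridPoint_thickening [NeZero N] {K : Set (ℝ × ℝ)} (hK : IsPreconnected K) {δ : ℝ}
    (hδ : (N : ℝ)⁻¹ < δ) {z w : ℝ × ℝ} (hz : z ∈ K) (hw : w ∈ K) :
    Reachable (gridPoint N ⁻¹' Metric.thickening δ K) (gridFloor N z) (gridFloor N w) := by
  have hfloor (z) {w : ℝ × ℝ} (h : dist z w < δ - (N : ℝ)⁻¹) :
      gridPoint N (gridFloor N z) ∈ Metric.ball w δ :=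
    (dist_triangle _ z _).trans_lt (by linarith [dist_gridPoint_gridFloor_le (N := N) z])
  have hnear {z w : ℝ × ℝ} (hz : z ∈ K) (h : dist z w < δ - (N : ℝ)⁻¹) :
      Reachable (gridPoint N ⁻¹' Metric.thickening δ K) (gridFloor N z) (gridFloor N w) ∧
      Reachable (gridPoint N ⁻¹' Metric.thickening δ K) (gridFloor N w) (gridFloor N z) := by
    have hz' := hfloor z (by rw [dist_self]; linarith)
    have hw' := hfloor w (w := z) (by rwa [dist_comm])
    have hmono := Set.preimage_mono (f := gridPoint N) (Metric.ball_subset_thickening hz δ)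
    exact ⟨(reachable_gridPoint_ball hz' hw').mono hmono,
      (reachable_gridPoint_ball hw' hz').mono hmono⟩
  refine (hK.induction₂ (fun z w =>
    Reachable (gridPoint N ⁻¹' Metric.thickening δ K) (gridFloor N z) (gridFloor N w) ∧
    Reachable (gridPoint N ⁻¹' Metric.thickening δ K) (gridFloor N w) (gridFloor N z))
    (fun z hz => ?_) (fun _ _ _ _ _ _ h h' => ⟨h.1.trans h'.1, h'.2.trans h.2⟩)
    (fun _ _ _ _ h => h.symm) hz hw).1
  filter_upwards [mem_nhdsWithin_of_mem_nhds (Metric.ball_mem_nhds z (sub_pos.2 hδ))] with w hw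
  exact hnear hz (by rwa [dist_comm])

lemma dist_add_latticeVec_lt {N : ℕ} [NeZero N] {x a : ℤ × ℤ} {p q : ℝ × ℝ} {r s : ℝ}
    (hp : dist (gridPoint N x) p < r) (hq : dist (gridPoint N (x + N • a)) q < s) :
    dist q (p + latticeVec a) < r + s := by
  rw [gridPoint_add_smul, dist_comm] at hq
  rw [← dist_add_right _ _ (latticeVec a)] at hp
  linarith [dist_triangle q (gridPoint N x + latticeVec a) (p + latticeVec a)]

end Mesh

end SquareGrid

open Filter Topology Metric in
lemma eventually_separated {K K' : Set (ℝ × ℝ)} (hK : IsCompact K) (hK' : IsCompact K') :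
    ∀ᶠ η in 𝓝[>] (0 : ℝ), ∀ a, (∃ x ∈ K, ∃ y ∈ K', dist x (y + latticeVec a) < η) →
      ∃ x ∈ K, ∃ y ∈ K', x = y + latticeVec a := by
  set C : Set (ℝ × ℝ) := (fun z : (ℝ × ℝ) × (ℝ × ℝ) => z.1 - z.2) '' (K ×ˢ K')
  have hC : IsCompact C := (hK.prod hK').image (by fun_prop)
  have hclosed : IsClosed (latticeVec '' {a | latticeVec a ∉ C}) :=
    isClosedEmbedding_latticeVec.isClosedMap _ (isClosed_discrete _)
  have hdisj : Disjoint C (latticeVec '' {a | latticeVec a ∉ C}) := by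
    rw [Set.disjoint_right]
    rintro _ ⟨a, ha, rfl⟩
    exact ha
  obtain ⟨δ, hδ, hthick⟩ := hdisj.exists_thickenings hC hclosed
  filter_upwards [Ioo_mem_nhdsGT hδ] with η hη a ⟨x, hx, y, hy, hxy⟩
  have ha : latticeVec a ∈ C := by
    by_contra ha
    refine Set.disjoint_left.1 hthick ?_ (self_subset_thickening hδ _ ⟨a, ha, rfl⟩)
    refine mem_thickening_iff.2 ⟨x - y, ⟨(x, y), ⟨hx, hy⟩, rfl⟩, ?_⟩
    rw [dist_comm, ← dist_add_right _ _ y, sub_add_cancel, add_comm _ y]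
    exact hxy.trans hη.2
  obtain ⟨⟨x', y'⟩, ⟨hx', hy'⟩, h⟩ := ha
  exact ⟨x', hx', y', hy', (sub_eq_iff_eq_add'.1 h)⟩

namespace TorusGraph

open SquareGrid Filter Topology Metric

variable {V D : Type*} {G : TorusGraph V D}

/-- The lift of an edge to the plane that starts at the chosen lift of its starting vertex. -/
noncomputable def lift (G : TorusGraph V D) (d : D) (t : I) : ℝ × ℝ :=
  G.arc d t - latticeVec (G.startShift d)

lemma continuous_lift (G : TorusGraph V D) (d : D) : Continuous (G.lift d) :=
  (G.arc d).continuous.sub continuous_const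

lemma lift_zero (d : D) : G.lift d 0 = G.pos (G.src d) := by
  rw [lift, arc_zero_eq, add_sub_cancel_right]

lemma lift_symm (d : D) (t : I) : G.lift d (σ t) = G.lift (G.rev d) t + latticeVec (G.shift d) := by
  rw [lift, lift, G.arc_rev, shift, latticeVec_sub]
  abel

lemma lift_one (d : D) : G.lift d 1 = G.pos (G.tgt d) + latticeVec (G.shift d) := by
  rw [← unitInterval.symm_zero, lift_symm, lift_zero, tgt]

lemma eq_of_pos_eq {v w : V} {a : ℤ × ℤ} (h : G.pos w = G.pos v + latticeVec a) :
    v = w ∧ a = 0 := by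
  obtain rfl := G.pos_inj v w a h.symm
  exact ⟨rfl, latticeVec_eq_zero.1 (left_eq_add.1 h)⟩

lemma eq_of_lift_eq_pos {d : D} {t : I} {w : V} {a : ℤ × ℤ}
    (h : G.lift d t = G.pos w + latticeVec a) :
    (w = G.src d ∧ a = 0) ∨ (w = G.tgt d ∧ a = G.shift d) := by
  rcases eq_or_ne t 0 with rfl | h0
  · exact Or.inl (eq_of_pos_eq (by rw [← h, lift_zero]))
  rcases eq_or_ne t 1 with rfl | h1
  · refine Or.inr ((eq_of_pos_eq (G := G) (a := a - G.shift d) ?_).imp_right sub_eq_zero.1)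
    rw [lift_one] at h
    rw [latticeVec_sub, ← add_sub_assoc, ← h, add_sub_cancel_right]
  · refine absurd ?_ (G.arc_ne_pos d t ⟨unitInterval.pos_iff_ne_zero.2 h0,
      unitInterval.lt_one_iff_ne_one.2 h1⟩ w (a + G.startShift d))
    rw [latticeVec_add, ← add_assoc, ← h, lift, sub_add_cancel]

lemma eq_of_lift_eq_lift {d e : D} (hde : e ≠ G.rev d) {s t : I} (hs : s ∈ Set.Ioo 0 1)
    (ht : t ∈ Set.Ioo 0 1) {a : ℤ × ℤ} (h : G.lift e t = G.lift d s + latticeVec a) :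
    d = e ∧ a = 0 := by
  have harc : G.arc d s + latticeVec (a + G.startShift e - G.startShift d) = G.arc e t := by
    rw [lift, lift, sub_eq_iff_eq_add] at h
    rw [h, latticeVec_sub, latticeVec_add]
    abel
  obtain ⟨rfl, rfl⟩ := (G.arc_disjoint d e s hs t ht _ harc).resolve_right fun h => hde h.1
  exact ⟨rfl, latticeVec_eq_zero.1 (left_eq_add.1 h)⟩

lemma exists_orientation [Finite D] (G : TorusGraph V D) :
    ∃ O : Set D, ∀ d, d ∈ O ↔ G.rev d ∉ O := by
  obtain ⟨f, hf⟩ := exists_injective_nat D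
  refine ⟨{d | f d < f (G.rev d)}, fun d => ?_⟩
  have := hf.ne (G.rev_ne d)
  simp only [Set.mem_ofPred_eq, G.rev_rev]
  lia

section Separation

variable (G)

lemma eventually_pos_separated [Finite V] : ∀ᶠ η in 𝓝[>] (0 : ℝ), ∀ v w a,
    dist (G.pos w) (G.pos v + latticeVec a) < η → v = w ∧ a = 0 := by
  have h := eventually_all.2 fun v => eventually_all.2 fun w =>
    eventually_separated (isCompact_singleton (x := G.pos w)) (isCompact_singleton (x := G.pos v))
  filter_upwards [h] with η hη v w a hdist
  obtain ⟨_, rfl, _, rfl, heq⟩ := hη v w a ⟨_, rfl, _, rfl, hdist⟩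
  exact eq_of_pos_eq heq

lemma eventually_lift_pos_separated [Finite V] [Finite D] : ∀ᶠ η in 𝓝[>] (0 : ℝ), ∀ d t w a,
    dist (G.lift d t) (G.pos w + latticeVec a) < η →
      (w = G.src d ∧ a = 0) ∨ (w = G.tgt d ∧ a = G.shift d) := by
  have h := eventually_all.2 fun d => eventually_all.2 fun w =>
    eventually_separated (isCompact_range (G.continuous_lift d))
      (isCompact_singleton (x := G.pos w))
  filter_upwards [h] with η hη d t w a hdist
  obtain ⟨_, ⟨t', rfl⟩, _, rfl, heq⟩ := hη d w a ⟨_, ⟨t, rfl⟩, _, rfl, hdist⟩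
  exact eq_of_lift_eq_pos heq

lemma eventually_lift_separated [Finite D] {J : Set I} (hJ : IsCompact J)
    (hJ' : J ⊆ Set.Ioo 0 1) :
    ∀ᶠ η in 𝓝[>] (0 : ℝ), ∀ d e, e ≠ G.rev d → ∀ a, ∀ s ∈ J, ∀ t ∈ J,
      dist (G.lift e t) (G.lift d s + latticeVec a) < η → d = e ∧ a = 0 := by
  have h := eventually_all.2 fun d => eventually_all.2 fun e =>
    eventually_separated (hJ.image (G.continuous_lift e)) (hJ.image (G.continuous_lift d))
  filter_upwards [h] with η hη d e hde a s hs t ht hdist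
  obtain ⟨_, ⟨t', ht', rfl⟩, _, ⟨s', hs', rfl⟩, heq⟩ :=
    hη d e a ⟨_, ⟨t, ht, rfl⟩, _, ⟨s, hs, rfl⟩, hdist⟩
  exact eq_of_lift_eq_lift hde (hJ' hs') (hJ' ht') heq

lemma exists_dist_lift_lt [Finite D] {r : ℝ} (hr : 0 < r) :
    ∃ c ∈ Set.Ioo (0 : I) 1, ∀ d, dist (G.lift d c) (G.pos (G.src d)) < r := by
  have h : ∀ᶠ c in 𝓝 (0 : I), ∀ d, dist (G.lift d c) (G.pos (G.src d)) < r :=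
    eventually_all.2 fun d => by
      have := (G.continuous_lift d).tendsto 0
      rw [lift_zero] at this
      exact tendsto_nhds.1 this r hr
  have : (𝓝[>] (0 : I)).NeBot := nhdsGT_neBot_of_exists_gt ⟨1, one_pos⟩
  obtain ⟨c, hc, hc'⟩ := ((h.filter_mono nhdsWithin_le_nhds).and (Ioo_mem_nhdsGT one_pos)).exists
  exact ⟨c, hc', hc⟩

end Separation

/-- The part of the lift of an edge between the parameters `c` and `1 - c`. -/
def core (G : TorusGraph V D) (c : I) (d : D) : Set (ℝ × ℝ) := G.lift d '' Set.uIcc c (σ c)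

lemma left_mem_core (G : TorusGraph V D) (c : I) (d : D) : G.lift d c ∈ G.core c d :=
  Set.mem_image_of_mem _ Set.left_mem_uIcc

lemma right_mem_core (G : TorusGraph V D) (c : I) (d : D) : G.lift d (σ c) ∈ G.core c d :=
  Set.mem_image_of_mem _ Set.right_mem_uIcc

lemma exists_reachable_core {N : ℕ} [NeZero N] {r δ : ℝ} {c : I} (hδ : 0 < δ) (hδr : δ ≤ r)
    (hN : (N : ℝ)⁻¹ < δ / 2) (hc : ∀ d, dist (G.lift d c) (G.pos (G.src d)) < r / 2) (d : D) :
    ∃ x ∈ gridPoint N ⁻¹' ball (G.pos (G.src d)) r,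
      ∃ y, y - N • G.shift d ∈ gridPoint N ⁻¹' ball (G.pos (G.tgt d)) r ∧
        x ∈ gridPoint N ⁻¹' thickening δ (G.core c d) ∧
        Reachable (gridPoint N ⁻¹' thickening δ (G.core c d)) x y := by
  have hfloor (z : ℝ × ℝ) : dist (gridPoint N (gridFloor N z)) z < δ / 2 :=
    (dist_gridPoint_gridFloor_le z).trans_lt hN
  have hend : dist (G.lift d (σ c)) (G.pos (G.tgt d) + latticeVec (G.shift d)) < r / 2 := by
    rw [lift_symm, dist_add_right]
    exact hc (G.rev d)
  refine ⟨gridFloor N (G.lift d c), ?_, gridFloor N (G.lift d (σ c)), ?_, ?_,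
    reachable_gridPoint_thickening
      (isPreconnected_uIcc.image _ (G.continuous_lift d).continuousOn) (by linarith)
      (G.left_mem_core c d) (G.right_mem_core c d)⟩
  · exact (dist_triangle _ (G.lift d c) _).trans_lt (by linarith [hc d, hfloor (G.lift d c)])
  · rw [Set.mem_preimage, mem_ball, ← dist_add_right _ _ (latticeVec (G.shift d)),
      ← gridPoint_add_smul, sub_add_cancel]
    exact (dist_triangle _ (G.lift d (σ c)) _).trans_lt (by linarith [hfloor (G.lift d (σ c))])
  · exact mem_thickening_iff.2 ⟨_, G.left_mem_core c d, (hfloor _).trans (half_lt_self hδ)⟩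

/-- The thickening whose disks and tubes consist of the grid points at distance less than `r` from
a vertex and less than `δ` from the core of an edge. -/
noncomputable def gridThickening {N : ℕ} [NeZero N] {O : Set D} {r δ ε η : ℝ} {c : I}
    (hδ : 0 < δ) (hδr : δ ≤ r) (hrε : 3 * r ≤ ε) (hδη : 2 * δ ≤ η) (hN : (N : ℝ)⁻¹ < δ / 2)
    (hO : ∀ d, d ∈ O ↔ G.rev d ∉ O)
    (hpos : ∀ v w a, dist (G.pos w) (G.pos v + latticeVec a) < ε → v = w ∧ a = 0)
    (hlift : ∀ d t w a, dist (G.lift d t) (G.pos w + latticeVec a) < ε →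
      (w = G.src d ∧ a = 0) ∨ (w = G.tgt d ∧ a = G.shift d))
    (hcore : ∀ d e, e ≠ G.rev d → ∀ a, ∀ s ∈ Set.uIcc c (σ c), ∀ t ∈ Set.uIcc c (σ c),
      dist (G.lift e t) (G.lift d s + latticeVec a) < η → d = e ∧ a = 0)
    (hc : ∀ d, dist (G.lift d c) (G.pos (G.src d)) < r / 2) :
    GridThickening G where
  N := N
  N_pos := NeZero.pos N
  orientation := O
  mem_orientation := hO _
  disk v := gridPoint N ⁻¹' ball (G.pos v) r
  finite_disk v := finite_gridPoint_preimage isBounded_ball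
  center v := gridFloor N (G.pos v)
  center_mem v := (dist_gridPoint_gridFloor_le _).trans_lt (by linarith)
  reachable_center := reachable_gridPoint_ball
    (mem_ball.2 ((dist_gridPoint_gridFloor_le _).trans_lt (by linarith)))
  disk_disjoint hx hxa := hpos _ _ _ ((dist_add_latticeVec_lt hx hxa).trans_le (by linarith))
  disk_separated {v _ _ e} he hea := by
    have hhead : dist (gridPoint N (head e)) (G.pos v) < r + (N : ℝ)⁻¹ :=
      (dist_triangle _ (gridPoint N e.1) _).trans_lt
        (by linarith [mem_ball.1 he, dist_gridPoint_head_le (N := N) e])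
    exact hpos _ _ _ ((dist_add_latticeVec_lt hhead hea).trans_le (by linarith))
  tube d := gridPoint N ⁻¹' thickening δ (G.core c d)
  finite_tube d := finite_gridPoint_preimage
    (isCompact_uIcc.image (G.continuous_lift d)).isBounded.thickening
  tube_disk {d w x a} hx hxa := by
    obtain ⟨_, ⟨t, -, rfl⟩, hxt⟩ := mem_thickening_iff.1 hx
    have hxt' : dist (gridPoint N (x - N • a + N • a)) (G.lift d t) < δ := by rwa [sub_add_cancel]
    exact hlift d t w a ((dist_add_latticeVec_lt hxa hxt').trans_le (by linarith))
  tube_disjoint {d e x a} hd he hx hxa := by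
    obtain ⟨_, ⟨s, hs, rfl⟩, hxs⟩ := mem_thickening_iff.1 hx
    obtain ⟨_, ⟨t, ht, rfl⟩, hxt⟩ := mem_thickening_iff.1 hxa
    exact hcore d e (fun h => (hO d).1 hd (h ▸ he)) a s hs t ht
      ((dist_add_latticeVec_lt hxs hxt).trans_le (by linarith))
  exists_walk d := exists_reachable_core hδ hδr hN hc d

theorem exists_gridModel [Finite V] [Finite D] (G : TorusGraph V D) : Nonempty (GridModel G) := by
  obtain ⟨O, hO⟩ := G.exists_orientation
  obtain ⟨ε, ⟨hpos, hlift⟩, hε⟩ := ((G.eventually_pos_separated.and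
    G.eventually_lift_pos_separated).and self_mem_nhdsWithin).exists
  obtain ⟨c, ⟨hc0, hc1⟩, hc⟩ := G.exists_dist_lift_lt (r := ε / 3 / 2) (by positivity)
  have hcore : Set.uIcc c (σ c) ⊆ Set.Ioo 0 1 := Set.ordConnected_Ioo.uIcc_subset ⟨hc0, hc1⟩
    ⟨unitInterval.lt_symm_comm.2 (by simpa using hc1),
      unitInterval.symm_lt_comm.2 (by simpa using hc0)⟩
  obtain ⟨η, hsep, hη⟩ :=
    ((G.eventually_lift_separated isCompact_uIcc hcore).and self_mem_nhdsWithin).exists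
  have hδ : 0 < min (η / 2) (ε / 3) := by positivity
  obtain ⟨N, hN, hNpos⟩ := (((tendsto_inv_atTop_nhds_zero_nat (𝕜 := ℝ)).eventually_lt_const
    (half_pos hδ)).and (eventually_gt_atTop 0)).exists
  have : NeZero N := ⟨hNpos.ne'⟩
  exact ⟨(gridThickening hδ (min_le_right _ _) (by linarith)
    (by linarith [min_le_left (η / 2) (ε / 3)]) hN hO hpos hlift hsep hc).gridModel⟩

end TorusGraph

theorem lemma4p1 {V D : Type*} [Fintype V] [Fintype D] [DecidableEq V] (G : TorusGraph V D)
    (i j : ℤ) (hij : ((i : ℝ), (j : ℝ)) ∈ G.unitFlowPolygon) :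
    ∃ ω ∈ G.unitFlows,
      G.homologyClass ω = ((i : ℝ), (j : ℝ)) ∧
      (∀ d, ω d = 0 ∨ ω d = 1 ∨ ω d = -1) ∧
      ∃ C : Set (Cycle D),
        (∀ c ∈ C, G.IsLoop c) ∧
        C.Pairwise G.VertexDisjoint ∧
        (∀ d, ω d = 1 ↔ ∃ c ∈ C, d ∈ c) := by
  obtain ⟨k, c, hc, hkc⟩ := exists_isCoprime_nsmul_eq (i, j)
  obtain ⟨M⟩ := G.exists_gridModel
  obtain ⟨ω, hω, hclass⟩ := hij
  have hess : ∀ d, G.essentialPart ω d ≠ 0 → G.IsEssential d := fun d =>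
    TorusGraph.isEssential_of_essentialPart_ne_zero
  obtain ⟨R⟩ := M.nonempty_rounding (TorusGraph.essentialPart_mem_unitFlows hω) hess (k := k)
    (c := c) (by rw [G.homologyClass_essentialPart, hclass, hkc]; rfl)
  choose L hL hLclass using R.exists_primitive_loop M hess hc
  have hdisj : Pairwise fun m m' => G.VertexDisjoint (L m).cycle (L m').cycle :=
    fun m m' hne d hd e he hsrc =>
      hne (R.disjoint (by simp [hL m d hd]) (by simp [hL m' e he]) hsrc)
  refine ⟨∑ m, (L m).flow, TorusGraph.sum_flow_mem_unitFlows hdisj, ?_,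
    TorusGraph.sum_flow_cases hdisj, Set.range fun m => (L m).cycle, ?_, ?_, fun d => ?_⟩
  · rw [G.homologyClass_sum, Finset.sum_congr rfl fun m _ => hLclass m, Finset.sum_const,
      Finset.card_univ, Fintype.card_fin, ← latticeVec_nsmul, hkc]
    rfl
  · rintro _ ⟨m, rfl⟩
    exact (L m).isLoop
  · exact hdisj.range_pairwise
  · rw [TorusGraph.sum_flow_eq_one_iff hdisj, Set.exists_range_iff]
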